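/- **Model.** There are $K$ platforms, a user and a data buyer. The user's data is $\theta\sim\mathcal N(0,I_d)$; platform $i$ has a unit vector $x_i\in\mathbb R^d$ and cost $c_i\ge 0$, the buyer a unit vector $y\in\mathbb R^d$; put $\gamma_i=x_i^\top y$, and assume $(x_i-\gamma_i y)^\top(x_j-\gamma_j y)=0$ for $i\ne j$. Let $s_i=x_i^\top\theta+\mathcal N(0,1)$ and $\tilde s_i=s_i+\mathcal N(0,\sigma_i^2)$ with independent noises. The information revealed about $Z$ by signals $\mathcal S$ is $\mathcal I(Z\mid\mathcal S)=\mathbb E[(Z-\mathbb E Z)^2]-\mathbb E[(Z-\mathbb E[Z\mid\mathcal S])^2]$; write $\mathcal I_i=\mathcal I(x_i^\top\theta\mid s_i)$ and $\mathcal I(\sigma_S)=\mathcal I(y^\top\theta\mid(\tilde s_i)_{i\in S})$. The game has four stages: (1) the platforms simultaneously choose noise levels $\sigma_i\ge0$ and entry $e_i\in\{0,1\}$; (2) the user chooses $a\in\{0,1\}^K$; (3) the platforms simultaneously choose prices $p_i\in\mathbb R$ ($p_i=0$ if $a_ie_i=0$); (4) the buyer chooses $b\in\{0,1\}^K$. With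 $S=\{i: e_i=a_i=b_i=1\}$ the utilities are: user $\sum_i a_ie_i\mathcal I_i-\alpha\,\mathcal I(\sigma_S)$; platform $i$: $a_i\mathcal I_i+b_ip_i-c_i$ if $e_i=1$ and $0$ if $e_i=0$; buyer $\beta\,\mathcal I(\sigma_S)-\sum_i b_ip_i$. An equilibrium is a pure-strategy subgame perfect equilibrium in which the user, if indifferent, plays her greatest best reply. Utilitarian welfare is the sum of all these utilities in the equilibrium outcome. Let $\beta>0$. Platform $i$ is of low cost if $c_i<\frac12$ and of high cost if $c_i>\frac12$. For $a,e\in\{0,1\}^K$ let $\Sigma_{a,e}$ be the set of $\sigma\in\mathbb R_+^K$ for which $a$ maximizes the user's utility when the platforms in $e$ have entered and the buyer purchases all offered data. Assume that $\sigma=0$ lies in $\Sigma_{\mathbf 0,e}$ for every $e$. For $e_i=1$ let $\Delta_i(\sigma,e)=\mathcal I(\sigma_{\{j:e_j=1\}})-\mathcal I(\sigma_{\{j\neq i:e_j=1\}})$, and put $$\bar\alpha=\frac{(K+1)^2}{8},\qquad \bar\beta=\sup_{\substack{i,\ e:\,e_i=1\\ \sigma\in\Sigma_{\mathbf 1,e}\cap\Sigma_{\mathbf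 0,e}}}\frac{c_i-\frac12}{\Delta_i(\sigma,e)},\qquad \underline\beta=\inf_{\substack{i,\ e:\,c_i>\frac12,\ e_i=1\\ \sigma\in\Sigma_{\mathbf 1,e}}}\frac{c_i-\frac12}{\Delta_i(\sigma,e)}$$ (with $\sup\emptyset=-\infty$, $\inf\emptyset=+\infty$; $\bar\beta,\underline\beta$ may depend on $\alpha$). **Corollary.** Let $\alpha\ge\bar\alpha$. 1. If $\beta\ge\bar\beta$, the welfare in every equilibrium is $K\left(\frac12+\frac{\beta}{2\alpha}\right)-\sum_{i=1}^Kc_i$. 2. If $\beta\le\underline\beta$ and $c_i\neq\frac12$ for all $i$, the welfare in every equilibrium is $\#\{i:c_i<\frac12\}\left(\frac12+\frac{\beta}{2\alpha}\right)-\sum_{i:\,c_i<1/2}c_i$. For given $x_1,\dots,x_K,y$ there is $\alpha_0$ such that for all $c,\alpha,\beta$ as above with $\alpha\ge\alpha_0$ an equilibrium exists in both cases. Hence welfare increases with the number of platforms in the first case and of low-cost platforms in the second: if a market with $K'$ platforms arises from one with $K$ platforms by adding platforms ($y$, $\alpha$, $\beta$ unchanged), both markets satisfy the assumptions above and $\alpha\ge(K'+1)^2/8$,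 then (1) if both are in the first case, every equilibrium welfare of the larger market is at least every equilibrium welfare of the smaller one, and strictly larger if $K'>K$ and $\beta>\bar\beta$ for the larger market; (2) if both are in the second case, the same inequality holds, strictly if the larger market has more low-cost platforms. -/

import Mathlib

open MeasureTheory ProbabilityTheory Finset
open scoped NNReal BigOperators

noncomputable section

namespace DataMarket

/-! ### Gaussian data, signals and revealed information -/

/-- All the randomness: the `d` coordinates of the user's feature vector `θ`, the `K` noises of the
signals that the platforms receive, and the `K` standardized noises that the platforms add. -/
abbrev Sample (K d : ℕ) : Type := (Fin d ⊕ Fin K ⊕ Fin K) → ℝ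

/-- All coordinates are independent standard Gaussians; in particular `θ ~ N(0, I_d)`. -/
def law (K d : ℕ) : Measure (Sample K d) := Measure.pi fun _ => gaussianReal 0 1

variable {K d : ℕ}

/-- The linear functional `vᵀ θ` of the user's data. -/
def feature (v : EuclideanSpace ℝ (Fin d)) (ω : Sample K d) : ℝ :=
  ∑ j, v j * ω (Sum.inl j)

/-- The signal `s_i = x_iᵀ θ + N(0,1)` that platform `i` receives if the user shares with it. -/
def signal (x : Fin K → EuclideanSpace ℝ (Fin d)) (i : Fin K) (ω : Sample K d) : ℝ :=
  feature (x i) ω + ω (Sum.inr (Sum.inl i))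

/-- The signal `s̃_i = s_i + N(0, σ_i²)` that platform `i` offers to the buyer. -/
def noisySignal (x : Fin K → EuclideanSpace ℝ (Fin d)) (σ : Fin K → ℝ≥0) (i : Fin K)
    (ω : Sample K d) : ℝ :=
  signal x i ω + (σ i : ℝ) * ω (Sum.inr (Sum.inr i))

/-- Revealed information about `Z` from observing what the sigma-algebra `m` encodes: the prior
mean squared error minus the expected posterior mean squared error. -/
def revealedInfo (Z : Sample K d → ℝ) (m : MeasurableSpace (Sample K d)) : ℝ :=
  (∫ ω, (Z ω - ∫ ω', Z ω' ∂(law K d)) ^ 2 ∂(law K d)) -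
    ∫ ω, (Z ω - ((law K d)[Z | m]) ω) ^ 2 ∂(law K d)

/-- `𝓘_i`: information about `x_iᵀ θ` revealed to platform `i` by `s_i`. -/
def infoPlatform (x : Fin K → EuclideanSpace ℝ (Fin d)) (i : Fin K) : ℝ :=
  revealedInfo (feature (x i)) (MeasurableSpace.comap (signal x i) inferInstance)

/-- `𝓘(σ_S)`: information about `yᵀ θ` revealed to the buyer by the noisy signals of the
platforms in `S` (nothing is observed from the others). -/
def infoBuyer (x : Fin K → EuclideanSpace ℝ (Fin d)) (y : EuclideanSpace ℝ (Fin d))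
    (σ : Fin K → ℝ≥0) (S : Finset (Fin K)) : ℝ :=
  revealedInfo (feature y)
    (MeasurableSpace.comap (fun ω (i : S) => noisySignal x σ i ω) inferInstance)

/-! ### The market and the utilities

Elements of `{0,1}^K` are represented by the subsets of `Fin K` on which they equal one:
`e` (platforms that enter), `a` (platforms the user shares with), `b` (offers the buyer accepts). -/

/-- Data of a three-layer data market with `K` platforms. -/
structure Market (K d : ℕ) where
  /-- characteristics of the platforms -/
  x : Fin K → EuclideanSpace ℝ (Fin d)
  /-- characteristics of the buyer -/
  y : EuclideanSpace ℝ (Fin d)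
  /-- service costs -/
  c : Fin K → ℝ
  /-- weight of the user's privacy loss -/
  α : ℝ
  /-- weight of the buyer's information gain -/
  β : ℝ

namespace Market

variable (M : Market K d)

/-- The correlation `γ_i = x_iᵀ y`. -/
def γ (i : Fin K) : ℝ := inner ℝ (M.x i) M.y

/-- The information revealed to the buyer under the decisions `σ, e, a, b`. -/
def info (σ : Fin K → ℝ≥0) (e a b : Finset (Fin K)) : ℝ :=
  infoBuyer M.x M.y σ (e ∩ a ∩ b)

/-- The user's utility. -/
def userUtility (σ : Fin K → ℝ≥0) (e a b : Finset (Fin K)) : ℝ :=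
  ∑ i ∈ e ∩ a, infoPlatform M.x i - M.α * M.info σ e a b

/-- The utility of platform `i`. -/
def platformUtility (i : Fin K) (e a : Finset (Fin K)) (p : Fin K → ℝ) (b : Finset (Fin K)) : ℝ :=
  if i ∈ e then
    (if i ∈ a then infoPlatform M.x i else 0) + (if i ∈ b then p i else 0) - M.c i
  else 0

/-- The buyer's utility. -/
def buyerUtility (σ : Fin K → ℝ≥0) (e a : Finset (Fin K)) (p : Fin K → ℝ)
    (b : Finset (Fin K)) : ℝ :=
  M.β * M.info σ e a b - ∑ i ∈ b, p i

/-! ### Subgame perfect equilibrium -/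

end Market

/-- A strategy profile of the four-stage game: the platforms choose noise levels and entry; the
user's sharing decision, the prices and the buyer's purchases are functions of the history. -/
structure Profile (K : ℕ) where
  σ : Fin K → ℝ≥0
  e : Finset (Fin K)
  user : (Fin K → ℝ≥0) → Finset (Fin K) → Finset (Fin K)
  price : (Fin K → ℝ≥0) → Finset (Fin K) → Finset (Fin K) → Fin K → ℝ
  buyer : (Fin K → ℝ≥0) → Finset (Fin K) → Finset (Fin K) → (Fin K → ℝ) → Finset (Fin K)

namespace Profile

variable (s : Profile K)

/-- Purchases that follow the history `(σ, e, a)` under the profile. -/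
def buyerAfter (σ : Fin K → ℝ≥0) (e a : Finset (Fin K)) : Finset (Fin K) :=
  s.buyer σ e a (s.price σ e a)

end Profile

namespace Market

variable (M : Market K d)

/-- Last stage: after every history the buyer maximizes her utility. -/
def BuyerOptimal (s : Profile K) : Prop :=
  ∀ σ e a p b, M.buyerUtility σ e a p b ≤ M.buyerUtility σ e a p (s.buyer σ e a p)

/-- Third stage: after every history the prices are a Nash equilibrium among the platforms that
have entered and hold the user's data, given the buyer's reaction. The price of a platform that has
no data to offer is irrelevant and set to zero. -/
def PriceEquilibrium (s : Profile K) : Prop :=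
  ∀ σ e a,
    (∀ i, i ∉ e ∩ a → s.price σ e a i = 0) ∧
    ∀ i ∈ e ∩ a, ∀ q : ℝ,
      M.platformUtility i e a (Function.update (s.price σ e a) i q)
          (s.buyer σ e a (Function.update (s.price σ e a) i q)) ≤
        M.platformUtility i e a (s.price σ e a) (s.buyerAfter σ e a)

/-- Second stage: after every history the user plays a best reply, and among her best replies the
one that shares with the most platforms (ties are broken in the platforms' favour). -/
def UserOptimal (s : Profile K) : Prop :=
  ∀ σ e,
    IsGreatest {a | ∀ a', M.userUtility σ e a' (s.buyerAfter σ e a') ≤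
      M.userUtility σ e a (s.buyerAfter σ e a)} (s.user σ e)

/-- The utility of platform `i` if the first-stage decisions are `(σ, e)` and the later stages
follow the profile. -/
def platformValue (s : Profile K) (i : Fin K) (σ : Fin K → ℝ≥0) (e : Finset (Fin K)) : ℝ :=
  M.platformUtility i e (s.user σ e) (s.price σ e (s.user σ e)) (s.buyerAfter σ e (s.user σ e))

/-- First stage: no platform gains by changing its own noise level and entry decision. -/
def PlatformEquilibrium (s : Profile K) : Prop :=
  ∀ (i : Fin K) (t : ℝ≥0) (e' : Finset (Fin K)), (∀ j, j ≠ i → (j ∈ e' ↔ j ∈ s.e)) →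
    M.platformValue s i (Function.update s.σ i t) e' ≤ M.platformValue s i s.σ s.e

/-- Equilibrium of the game: subgame perfect equilibrium in pure strategies. -/
structure IsEquilibrium (s : Profile K) : Prop where
  buyer : M.BuyerOptimal s
  price : M.PriceEquilibrium s
  user : M.UserOptimal s
  platform : M.PlatformEquilibrium s

/-- Utilitarian welfare of the outcome of a profile: the sum of the utilities of the platforms, the
user and the buyer. -/
def welfare (s : Profile K) : ℝ :=
  let a := s.user s.σ s.e
  let p := s.price s.σ s.e a
  let b := s.buyerAfter s.σ s.e a
  ∑ i, M.platformUtility i s.e a p b + M.userUtility s.σ s.e a b + M.buyerUtility s.σ s.e a p b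

/-! ### Standing assumptions and thresholds -/

/-- `Σ_{a,e}`: the noise levels at which, if the platforms in `e` enter and the buyer purchases all
offered data, sharing according to `a` is optimal for the user. -/
def region (a e : Finset (Fin K)) : Set (Fin K → ℝ≥0) :=
  {σ | ∀ a', M.userUtility σ e a' univ ≤ M.userUtility σ e a univ}

/-- Standing assumptions: unit characteristic vectors, nonnegative costs, a buyer who values
information, substitutes, and a user who shares with nobody if no noise is added. -/
structure Admissible : Prop where
  norm_x : ∀ i, ‖M.x i‖ = 1
  norm_y : ‖M.y‖ = 1
  cost_nonneg : ∀ i, 0 ≤ M.c i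
  β_pos : 0 < M.β
  substitutes : ∀ i j, i ≠ j → inner ℝ (M.x i - M.γ i • M.y) (M.x j - M.γ j • M.y) = 0
  privacy : ∀ e : Finset (Fin K), (fun _ => 0) ∈ M.region ∅ e

/-- The marginal information of platform `i` when all platforms in `e` share with the buyer. -/
def marginal (σ : Fin K → ℝ≥0) (e : Finset (Fin K)) (i : Fin K) : ℝ :=
  M.info σ e univ univ - M.info σ e (univ.erase i) univ

/-- The upper threshold on `β`: the supremum of `(c_i - 1/2) / marginal` over `i ∈ e` and the noise
levels at which the user is indifferent between sharing with all of `e` and with nobody. -/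
def betaBar : EReal :=
  ⨆ (i : Fin K) (e : Finset (Fin K)) (_ : i ∈ e) (σ ∈ M.region univ e ∩ M.region ∅ e),
    (((M.c i - 1 / 2) / M.marginal σ e i : ℝ) : EReal)

/-- The lower threshold on `β`: the infimum of `(c_i - 1/2) / marginal` over high-cost `i ∈ e` and
the noise levels at which the user shares with all of `e`; it is `+∞` without high-cost platforms. -/
def betaUnder : EReal :=
  ⨅ (i : Fin K) (_ : 1 / 2 < M.c i) (e : Finset (Fin K)) (_ : i ∈ e) (σ ∈ M.region univ e),
    (((M.c i - 1 / 2) / M.marginal σ e i : ℝ) : EReal)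

/-- The low-cost platforms. -/
def lowCost : Finset (Fin K) := univ.filter fun i => M.c i < 1 / 2

/-- The first regime: `β` is at least the upper threshold. -/
def HighBeta : Prop := M.betaBar ≤ (M.β : EReal)

/-- The second regime: every platform is of high or of low cost, and `β` is at most the lower
threshold. -/
def LowBeta : Prop := (∀ i, M.c i ≠ 1 / 2) ∧ (M.β : EReal) ≤ M.betaUnder

/-- `M'` arises from `M` by adding platforms (possibly none): `M` is the submarket of `M'` on the
platforms in the range of an injection. -/
def IsSubmarket {K' : ℕ} (M : Market K d) (M' : Market K' d) : Prop :=
  M.y = M'.y ∧ M.α = M'.α ∧ M.β = M'.β ∧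
    ∃ f : Fin K → Fin K', Function.Injective f ∧ (∀ i, M.x i = M'.x (f i)) ∧
      ∀ i, M.c i = M'.c (f i)

end Market

/-- The threshold `(K+1)²/8` on `α`. -/
def alphaBar (K : ℕ) : ℝ := ((K : ℝ) + 1) ^ 2 / 8

end DataMarket

end

/-!
The theorem reduces the market to the entry game of the first stage, and the entry game to a
comparison of precisions.

*Information.* By the substitutes assumption the noise in the signals, modulo their components along
`yᵀθ`, is independent across platforms. So the signal of platform `i` adds the precision
`weight i (σ i) = γ_i² / (2 - γ_i² + σ_i²)`, and the buyer learns `gain h = h / (1 + h)` from total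
precision `h` (`infoBuyer_eq`). A platform learns `1 / 2` (`infoPlatform_eq_half`). Since `gain` is
concave, the buyer's value is submodular and the user's utility `net` is supermodular in the set of
sellers.

*Subgames.* By submodularity a platform sells for sure below its marginal value `β * marg`, and the
buyer never pays more when she buys everything; so in every equilibrium prices are marginal values
and all data is bought (`IsEquilibrium.competitive`). By supermodularity the user has a greatest
best reply (`exists_bestShare`). What remains is the entry game (`EntryEquilibrium`), from which an
equilibrium of the market can be recovered (`EntryEquilibrium.exists_isEquilibrium`).

*Welfare.* With enough noise an entrant is always served, so all entrants are. A platform that adds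
noise would add slightly less unless the user is about to drop it; hence the smallest best reply of
the user consists of noiseless platforms, and the privacy assumption makes it worthless. So the user
is indifferent (`EntryEquilibrium.net_eq_zero`), `gain` equals `#e / (2α)`, and every entrant
contributes `1 / 2 + β / (2α) - c_i` to welfare (`IsEquilibrium.welfare_eq_sum`). The thresholds on
`β`, tested on a single platform that keeps the user indifferent, determine the sign of this
contribution. In the first regime a platform that stays out has contribution zero
(`EntryEquilibrium.le_cost_of_notMem`), in the second one a high-cost platform that enters.

*Existence.* For large `α` all platforms of a set `e` can be given the same precision
`1 / (2α - #e)`. The only tempting deviation, more noise that crowds out the other sellers, then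
leaves the deviator with too little information to sell (`exists_entryEquilibrium`).
-/

/-! ### Gaussian signals and revealed information -/

namespace DataMarket

section Gaussian

variable {K d : ℕ}

/-- The linear statistic of the sample with coefficient vector `a`. -/
noncomputable def linStat (a : Fin d ⊕ Fin K ⊕ Fin K → ℝ) (ω : Sample K d) : ℝ :=
  ∑ k, a k * ω k

instance isProbabilityMeasure_law : IsProbabilityMeasure (law K d) := by
  unfold law; infer_instance

lemma iIndepFun_eval : iIndepFun (fun k (ω : Sample K d) => ω k) (law K d) :=
  iIndepFun_pi (X := fun _ => id) fun _ => aemeasurable_id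

lemma hasLaw_eval (k : Fin d ⊕ Fin K ⊕ Fin K) :
    HasLaw (fun ω : Sample K d => ω k) (gaussianReal 0 1) (law K d) :=
  (measurePreserving_eval (fun _ => gaussianReal 0 1) k).hasLaw

lemma hasGaussianLaw_id : HasGaussianLaw (fun ω : Sample K d => (fun k => ω k)) (law K d) :=
  iIndepFun_eval.hasGaussianLaw fun k => (hasLaw_eval k).hasGaussianLaw

/-- `linStat a` as a continuous linear functional. -/
noncomputable def linStatCLM (a : Fin d ⊕ Fin K ⊕ Fin K → ℝ) : Sample K d →L[ℝ] ℝ :=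
  ∑ k, a k • ContinuousLinearMap.proj k

lemma linStatCLM_apply (a : Fin d ⊕ Fin K ⊕ Fin K → ℝ) (ω : Sample K d) :
    linStatCLM a ω = linStat a ω := by
  simp [linStatCLM, linStat]

lemma hasGaussianLaw_linStat (a : Fin d ⊕ Fin K ⊕ Fin K → ℝ) :
    HasGaussianLaw (linStat a) (law K d) := by
  have := (hasGaussianLaw_id (K := K) (d := d)).map_fun (linStatCLM a)
  simpa only [linStatCLM_apply] using this

lemma measurable_linStat (a : Fin d ⊕ Fin K ⊕ Fin K → ℝ) : Measurable (linStat a) := by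
  unfold linStat; fun_prop

lemma integral_linStat (a : Fin d ⊕ Fin K ⊕ Fin K → ℝ) : ∫ ω, linStat a ω ∂(law K d) = 0 := by
  unfold linStat
  rw [integral_finsetSum _ fun k _ => ((hasLaw_eval k).hasGaussianLaw.integrable).const_mul _]
  refine Finset.sum_eq_zero fun k _ => ?_
  rw [integral_const_mul, (hasLaw_eval k).integral_eq, integral_id_gaussianReal, mul_zero]

lemma covariance_eval (k l : Fin d ⊕ Fin K ⊕ Fin K) :
    cov[fun ω => ω k, fun ω => ω l; law K d] = if k = l then 1 else 0 := by
  split_ifs with h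
  · subst h
    rw [covariance_self (measurable_pi_apply k).aemeasurable, (hasLaw_eval k).variance_eq,
      variance_id_gaussianReal]
    simp
  · exact (iIndepFun_eval.indepFun h).covariance_eq_zero
      (hasLaw_eval k).hasGaussianLaw.memLp_two (hasLaw_eval l).hasGaussianLaw.memLp_two

lemma covariance_linStat (a b : Fin d ⊕ Fin K ⊕ Fin K → ℝ) :
    cov[linStat a, linStat b; law K d] = a ⬝ᵥ b := by
  unfold linStat
  rw [covariance_fun_sum_fun_sum
    (fun k => ((hasLaw_eval k).hasGaussianLaw.memLp_two).const_mul _)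
    (fun k => ((hasLaw_eval k).hasGaussianLaw.memLp_two).const_mul _)]
  simp [covariance_const_mul_left, covariance_const_mul_right, covariance_eval, dotProduct,
    mul_comm]

lemma integral_linStat_sq (a : Fin d ⊕ Fin K ⊕ Fin K → ℝ) :
    ∫ ω, linStat a ω ^ 2 ∂(law K d) = a ⬝ᵥ a := by
  rw [← covariance_linStat, covariance_self (measurable_linStat a).aemeasurable,
    variance_of_integral_eq_zero (measurable_linStat a).aemeasurable (integral_linStat a)]

/-- Statistics whose coefficient vectors are orthogonal are independent, being jointly Gaussian and
uncorrelated. -/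
lemma indepFun_linStat {κ : Type*} [Fintype κ] (r : Fin d ⊕ Fin K ⊕ Fin K → ℝ)
    (u : κ → Fin d ⊕ Fin K ⊕ Fin K → ℝ) (h : ∀ j, r ⬝ᵥ u j = 0) :
    IndepFun (linStat r) (fun ω j => linStat (u j) ω) (law K d) := by
  have hg : HasGaussianLaw
      (fun ω : Sample K d => (fun _ : Unit => linStat r ω, fun j => linStat (u j) ω)) (law K d) := by
    have := (hasGaussianLaw_id (K := K) (d := d)).map_fun
      ((ContinuousLinearMap.pi fun _ : Unit => linStatCLM r).prod
        (ContinuousLinearMap.pi fun j => linStatCLM (u j)))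
    convert! this using 3
    · exact funext fun _ => (linStatCLM_apply _ _).symm
    · exact funext fun _ => (linStatCLM_apply _ _).symm
  have := hg.indepFun_of_covariance_eval (X := fun _ : Unit => linStat r)
    (Y := fun j => linStat (u j)) (fun _ j => by rw [covariance_linStat, h])
  exact this.comp (φ := fun f : Unit → ℝ => f ()) (ψ := id) (measurable_pi_apply _) measurable_id

/-- If the residual `R` of the estimate `φ ∘ T` of `Z` is centred and independent of the
observation `T`, then the estimate is the posterior mean, and the residual is what remains. -/
lemma revealedInfo_of_indepFun {F : Type*} [mF : MeasurableSpace F] {Z R : Sample K d → ℝ}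
    {T : Sample K d → F} {φ : F → ℝ} (hT : Measurable T) (hφ : Measurable φ)
    (hR : Measurable R) (hZ : Integrable Z (law K d)) (hRi : Integrable R (law K d))
    (hR0 : ∫ ω, R ω ∂(law K d) = 0) (hZ0 : ∫ ω, Z ω ∂(law K d) = 0)
    (hdec : ∀ ω, Z ω = R ω + φ (T ω)) (hind : IndepFun R T (law K d)) :
    revealedInfo Z (mF.comap T) =
      ∫ ω, Z ω ^ 2 ∂(law K d) - ∫ ω, R ω ^ 2 ∂(law K d) := by
  have hle : mF.comap T ≤ MeasurableSpace.pi := hT.comap_le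
  have hφi : Integrable (φ ∘ T) (law K d) := by
    have : φ ∘ T = Z - R := by ext ω; simp [hdec]
    rw [this]; exact hZ.sub hRi
  have h1 : (law K d)[R | mF.comap T] =ᵐ[law K d] fun _ => 0 := by
    have := condExp_indep_eq (μ := law K d) hR.comap_le hle
      (comap_measurable R).stronglyMeasurable hind
    simpa only [hR0] using this
  have h2 : (law K d)[φ ∘ T | mF.comap T] = φ ∘ T :=
    condExp_of_stronglyMeasurable hle
      (hφ.comp (comap_measurable T)).stronglyMeasurable hφi
  have h3 : (law K d)[Z | mF.comap T] =ᵐ[law K d] φ ∘ T := by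
    have hZe : Z = R + φ ∘ T := by ext ω; simp [hdec]
    rw [hZe]
    refine (condExp_add hRi hφi _).trans ?_
    filter_upwards [h1] with ω hω
    simp [hω, h2]
  unfold revealedInfo
  rw [hZ0]
  congr 1
  · simp
  · refine integral_congr_ae ?_
    filter_upwards [h3] with ω hω
    rw [hω, hdec]; simp

/-- The normal equations: if `z - ∑ c_i u_i` is orthogonal to every `u_j`, then `∑ c_i u_i` is the
posterior mean of the statistic `z` given the statistics `u`. -/
lemma revealedInfo_linStat {κ : Type*} [Fintype κ]
    (z : Fin d ⊕ Fin K ⊕ Fin K → ℝ) (u : κ → Fin d ⊕ Fin K ⊕ Fin K → ℝ) (c : κ → ℝ)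
    (h : ∀ j, (z - ∑ i, c i • u i) ⬝ᵥ u j = 0) :
    revealedInfo (linStat z)
      (MeasurableSpace.comap (fun (ω : Sample K d) j => linStat (u j) ω) inferInstance) =
      ∑ i, c i * (u i ⬝ᵥ z) := by
  have key := revealedInfo_of_indepFun (K := K) (d := d) (Z := linStat z)
    (R := linStat (z - ∑ i, c i • u i)) (T := fun ω j => linStat (u j) ω)
    (φ := fun f => ∑ i, c i * f i)
    (measurable_pi_lambda _ fun j => measurable_linStat _) (by fun_prop) (measurable_linStat _)
    (hasGaussianLaw_linStat _).integrable (hasGaussianLaw_linStat _).integrable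
    (integral_linStat _) (integral_linStat _)
    (fun ω => by
      simp only [linStat, Pi.sub_apply, Finset.sum_apply, Pi.smul_apply, smul_eq_mul, sub_mul,
        Finset.sum_sub_distrib, Finset.sum_mul, Finset.mul_sum]
      rw [Finset.sum_comm (s := univ (α := κ))]
      simp [mul_assoc])
    (indepFun_linStat _ _ h)
  rw [key, integral_linStat_sq, integral_linStat_sq]
  have h0 : (z - ∑ i, c i • u i) ⬝ᵥ (∑ i, c i • u i) = 0 := by
    rw [dotProduct_sum]
    exact Finset.sum_eq_zero fun i _ => by rw [dotProduct_smul, h, smul_zero]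
  have h1 : (z - ∑ i, c i • u i) ⬝ᵥ (z - ∑ i, c i • u i) = (z - ∑ i, c i • u i) ⬝ᵥ z := by
    conv_lhs => rw [dotProduct_sub, h0, sub_zero]
  rw [h1, sub_dotProduct, sum_dotProduct]
  simp [smul_dotProduct]

/-- The coefficients of `feature v`. -/
def featureVec (v : EuclideanSpace ℝ (Fin d)) : Fin d ⊕ Fin K ⊕ Fin K → ℝ :=
  Sum.elim v (Sum.elim 0 0)

/-- The coefficients of `noisySignal x σ i`. -/
def signalVec (x : Fin K → EuclideanSpace ℝ (Fin d)) (σ : Fin K → ℝ≥0) (i : Fin K) :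
    Fin d ⊕ Fin K ⊕ Fin K → ℝ :=
  Sum.elim (x i) (Sum.elim (Pi.single i 1) (Pi.single i (σ i : ℝ)))

lemma linStat_featureVec (v : EuclideanSpace ℝ (Fin d)) :
    linStat (K := K) (featureVec v) = feature v := by
  ext ω; simp [linStat, featureVec, feature]

lemma linStat_signalVec (x : Fin K → EuclideanSpace ℝ (Fin d)) (σ : Fin K → ℝ≥0) (i : Fin K) :
    linStat (signalVec x σ i) = noisySignal x σ i := by
  ext ω
  simp [linStat, signalVec, noisySignal, signal, feature, Pi.single_apply, add_assoc]

lemma dotProduct_eq_inner (v w : EuclideanSpace ℝ (Fin d)) :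
    (v : Fin d → ℝ) ⬝ᵥ (w : Fin d → ℝ) = inner ℝ v w := by
  simp [PiLp.inner_apply, dotProduct, mul_comm]

lemma featureVec_dotProduct_signalVec (v : EuclideanSpace ℝ (Fin d))
    (x : Fin K → EuclideanSpace ℝ (Fin d)) (σ : Fin K → ℝ≥0) (i : Fin K) :
    featureVec v ⬝ᵥ signalVec x σ i = inner ℝ v (x i) := by
  simp [featureVec, signalVec, dotProduct_eq_inner]

lemma signalVec_dotProduct_signalVec (x : Fin K → EuclideanSpace ℝ (Fin d)) (σ : Fin K → ℝ≥0)
    (i j : Fin K) :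
    signalVec x σ i ⬝ᵥ signalVec x σ j =
      inner ℝ (x i) (x j) + if i = j then 1 + (σ i : ℝ) ^ 2 else 0 := by
  simp only [signalVec, sumElim_dotProduct_sumElim, dotProduct_eq_inner, single_dotProduct,
    Pi.single_apply]
  split_ifs with h
  · subst h; ring
  · simp

/-- A platform with a unit vector learns exactly half of the unit variance. -/
theorem infoPlatform_eq_half {x : Fin K → EuclideanSpace ℝ (Fin d)} {i : Fin K}
    (hx : ‖x i‖ = 1) : infoPlatform x i = 1 / 2 := by
  have h := revealedInfo_linStat (K := K) (d := d) (featureVec (x i))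
    (fun _ : Unit => signalVec x 0 i) (fun _ => 1 / 2) (fun _ => by
      simp [featureVec_dotProduct_signalVec, signalVec_dotProduct_signalVec, sub_dotProduct,
        smul_dotProduct, hx]
      norm_num)
  have hc : MeasurableSpace.comap
      (fun (ω : Sample K d) (_ : Unit) => linStat (signalVec x 0 i) ω) inferInstance =
      MeasurableSpace.comap (signal x i) inferInstance := by
    have : (fun (ω : Sample K d) (_ : Unit) => linStat (signalVec x 0 i) ω) =
        (MeasurableEquiv.funUnique Unit ℝ).symm ∘ signal x i := by
      ext ω j; simp [linStat_signalVec, noisySignal, MeasurableEquiv.funUnique]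
    rw [this, ← MeasurableSpace.comap_comp,
      (MeasurableEquiv.funUnique Unit ℝ).symm.measurableEmbedding.comap_eq]
  rw [hc, linStat_featureVec] at h
  rw [infoPlatform, h]
  simp [dotProduct_comm _ (featureVec (x i)), featureVec_dotProduct_signalVec, hx]

end Gaussian

namespace Market

variable {K d : ℕ} (M : Market K d)

/-- The precision about `yᵀθ` that the signal of platform `i` contributes at noise level `t`:
modulo its component `γ_i yᵀθ`, the signal is noise of variance `2 - γ_i² + t²`. -/
noncomputable def weight (i : Fin K) (t : ℝ≥0) : ℝ :=
  M.γ i ^ 2 / (2 - M.γ i ^ 2 + (t : ℝ) ^ 2)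

/-- The total precision of the signals of the platforms in `S`. -/
noncomputable def totalWeight (σ : Fin K → ℝ≥0) (S : Finset (Fin K)) : ℝ :=
  ∑ i ∈ S, M.weight i (σ i)

variable {M}

lemma γ_sq_le_one (hM : M.Admissible) (i : Fin K) : M.γ i ^ 2 ≤ 1 := by
  have h := abs_real_inner_le_norm (M.x i) M.y
  rw [hM.norm_x, hM.norm_y, one_mul] at h
  exact (sq_le_one_iff_abs_le_one _).2 h

lemma inner_x_x (hM : M.Admissible) {i j : Fin K} (hij : i ≠ j) :
    inner ℝ (M.x i) (M.x j) = M.γ i * M.γ j := by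
  have h := hM.substitutes i j hij
  have hy : inner ℝ M.y M.y = (1 : ℝ) := by
    rw [real_inner_self_eq_norm_sq, hM.norm_y]; norm_num
  have hi : inner ℝ M.y (M.x j) = M.γ j := real_inner_comm _ _
  have hj : inner ℝ (M.x i) M.y = M.γ i := rfl
  simp only [inner_sub_left, inner_sub_right, real_inner_smul_left, real_inner_smul_right, hy, hi,
    hj] at h
  linarith

lemma noise_pos (hM : M.Admissible) (i : Fin K) (t : ℝ≥0) : 0 < 2 - M.γ i ^ 2 + (t : ℝ) ^ 2 := by
  nlinarith [γ_sq_le_one hM i, sq_nonneg (t : ℝ)]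

lemma weight_nonneg (hM : M.Admissible) (i : Fin K) (t : ℝ≥0) : 0 ≤ M.weight i t :=
  div_nonneg (sq_nonneg _) (noise_pos hM i t).le

lemma totalWeight_nonneg (hM : M.Admissible) (σ : Fin K → ℝ≥0) (S : Finset (Fin K)) :
    0 ≤ M.totalWeight σ S :=
  Finset.sum_nonneg fun i _ => weight_nonneg hM i _

/-- Modulo `yᵀθ` the signals are independent by the substitutes assumption, so their precisions
add up, and the prior has precision one. -/
theorem infoBuyer_eq (hM : M.Admissible) (σ : Fin K → ℝ≥0) (S : Finset (Fin K)) :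
    infoBuyer M.x M.y σ S = M.totalWeight σ S / (1 + M.totalWeight σ S) := by
  set H := M.totalWeight σ S with hH
  have hH0 : 0 ≤ H := totalWeight_nonneg hM σ S
  have hHS : ∑ i : S, M.weight i (σ i) = H := Finset.sum_coe_sort S fun i => M.weight i (σ i)
  have hy : ∀ i, inner ℝ M.y (M.x i) = M.γ i := fun i => real_inner_comm _ _
  let c : S → ℝ := fun i => M.γ i / (2 - M.γ i ^ 2 + (σ i : ℝ) ^ 2) / (1 + H)
  have hcγ : ∑ i : S, c i * M.γ i = H / (1 + H) := by
    have : ∑ i : S, c i * M.γ i = (∑ i : S, M.weight i (σ i)) / (1 + H) := by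
      rw [Finset.sum_div]
      refine Finset.sum_congr rfl fun i _ => ?_
      simp only [c, weight]
      ring
    rw [this, hHS]
  have hgram : ∀ i j : S, signalVec M.x σ i ⬝ᵥ signalVec M.x σ j =
      M.γ i * M.γ j + if i = j then 2 - M.γ i ^ 2 + (σ i : ℝ) ^ 2 else 0 := by
    intro i j
    rw [signalVec_dotProduct_signalVec]
    by_cases hij : i = j
    · subst hij
      rw [real_inner_self_eq_norm_sq, hM.norm_x]
      simp only [if_true]
      ring
    · have hij' : (i : Fin K) ≠ j := fun h => hij (Subtype.ext h)
      rw [inner_x_x hM hij', if_neg hij, if_neg hij']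
  have key := revealedInfo_linStat (featureVec M.y) (fun i : S => signalVec M.x σ i) c
    (fun j => by
      rw [sub_dotProduct, featureVec_dotProduct_signalVec, hy, sum_dotProduct]
      simp only [smul_dotProduct, hgram, smul_eq_mul, mul_add, Finset.sum_add_distrib, mul_ite,
        mul_zero, Finset.sum_ite_eq', Finset.mem_univ, if_true, ← mul_assoc]
      rw [← Finset.sum_mul, hcγ]
      have := noise_pos hM j (σ j)
      simp only [c]
      field_simp
      ring)
  simp only [linStat_featureVec, linStat_signalVec] at key
  rw [infoBuyer, key, ← hcγ]
  refine Finset.sum_congr rfl fun i _ => ?_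
  rw [dotProduct_comm, featureVec_dotProduct_signalVec, hy]

end Market
end DataMarket

/-! ### Submodular information and the user's best reply -/

namespace DataMarket

/-- The information revealed about a standard Gaussian by signals of total precision `h`. -/
noncomputable def gain (h : ℝ) : ℝ := h / (1 + h)

lemma gain_zero : gain 0 = 0 := by simp [gain]

lemma gain_add_sub_gain {h v : ℝ} (hh : 0 ≤ h) (hv : 0 ≤ v) :
    gain (h + v) - gain h = v / ((1 + h) * (1 + h + v)) := by
  unfold gain
  field_simp
  ring

lemma gain_lt_gain {h h' : ℝ} (hh : 0 ≤ h) (hlt : h < h') : gain h < gain h' := by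
  unfold gain
  rw [div_lt_div_iff₀ (by linarith) (by linarith)]
  linarith

lemma gain_le_gain {h h' : ℝ} (hh : 0 ≤ h) (hle : h ≤ h') : gain h ≤ gain h' :=
  hle.eq_or_lt.elim (fun h => h ▸ le_rfl) fun h => (gain_lt_gain hh h).le

lemma gain_le_gain_iff {h h' : ℝ} (hh : 0 ≤ h) (hh' : 0 ≤ h') : gain h ≤ gain h' ↔ h ≤ h' :=
  ⟨fun hg => not_lt.1 fun hlt => hg.not_gt (gain_lt_gain hh' hlt), gain_le_gain hh⟩

lemma gain_lt_one {h : ℝ} (hh : 0 ≤ h) : gain h < 1 := by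
  unfold gain
  rw [div_lt_one (by linarith)]
  linarith

/-- The precision at which `gain` takes the value `r`. -/
lemma gain_div_one_sub {r : ℝ} (hr : r < 1) : gain (r / (1 - r)) = r := by
  have : (1 - r) ≠ 0 := by linarith
  unfold gain
  field_simp
  ring

lemma gain_add_sub_gain_le {h v : ℝ} (hh : 0 ≤ h) (hv : 0 ≤ v) : gain (h + v) - gain h ≤ v := by
  rw [gain_add_sub_gain hh hv]
  exact div_le_self hv (by nlinarith)

/-- Strictly decreasing increments: `gain` is strictly concave. -/
lemma gain_increment_lt {h h' v : ℝ} (hh : 0 ≤ h) (hlt : h < h') (hv : 0 < v) :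
    gain (h' + v) - gain h' < gain (h + v) - gain h := by
  have hh' := hh.trans_lt hlt
  rw [gain_add_sub_gain hh hv.le, gain_add_sub_gain hh'.le hv.le]
  refine div_lt_div_of_pos_left hv (by positivity) ?_
  exact mul_lt_mul'' (by linarith) (by linarith) (by linarith) (by linarith)

lemma gain_increment_le {h h' v : ℝ} (hh : 0 ≤ h) (hle : h ≤ h') (hv : 0 ≤ v) :
    gain (h' + v) - gain h' ≤ gain (h + v) - gain h := by
  rcases hle.eq_or_lt with rfl | hlt
  · exact le_rfl
  rcases hv.eq_or_lt with rfl | hv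
  · simp
  · exact (gain_increment_lt hh hlt hv).le

namespace Market

variable {K d : ℕ} (M : Market K d)

/-- The marginal information of platform `i` among the platforms in `A`. -/
noncomputable def marg (σ : Fin K → ℝ≥0) (A : Finset (Fin K)) (i : Fin K) : ℝ :=
  gain (M.totalWeight σ A) - gain (M.totalWeight σ (A.erase i))

/-- The user's utility from sharing with exactly the entrants in `A`, all of whose offers are
bought. -/
noncomputable def net (σ : Fin K → ℝ≥0) (A : Finset (Fin K)) : ℝ :=
  (A.card : ℝ) / 2 - M.α * gain (M.totalWeight σ A)

/-- `A` is the greatest of the subsets of `e` that are best for the user, given that all offers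
are bought. -/
def BestShare (σ : Fin K → ℝ≥0) (e A : Finset (Fin K)) : Prop :=
  IsGreatest {A | A ⊆ e ∧ ∀ T ⊆ e, M.net σ T ≤ M.net σ A} A

variable {M}

lemma totalWeight_mono (hM : M.Admissible) (σ : Fin K → ℝ≥0) {S T : Finset (Fin K)} (h : S ⊆ T) :
    M.totalWeight σ S ≤ M.totalWeight σ T :=
  Finset.sum_le_sum_of_subset_of_nonneg h fun i _ _ => weight_nonneg hM i _

lemma totalWeight_congr {σ σ' : Fin K → ℝ≥0} {S : Finset (Fin K)} (h : ∀ i ∈ S, σ i = σ' i) :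
    M.totalWeight σ S = M.totalWeight σ' S :=
  Finset.sum_congr rfl fun i hi => by rw [h i hi]

lemma totalWeight_erase_add (σ : Fin K → ℝ≥0) {S : Finset (Fin K)} {i : Fin K} (hi : i ∈ S) :
    M.totalWeight σ (S.erase i) + M.weight i (σ i) = M.totalWeight σ S :=
  Finset.sum_erase_add _ _ hi

lemma totalWeight_insert (σ : Fin K → ℝ≥0) {S : Finset (Fin K)} {i : Fin K} (hi : i ∉ S) :
    M.totalWeight σ (insert i S) = M.totalWeight σ S + M.weight i (σ i) := by
  rw [totalWeight, Finset.sum_insert hi, add_comm]; rfl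

lemma totalWeight_update_of_notMem (σ : Fin K → ℝ≥0) {S : Finset (Fin K)} {i : Fin K}
    (t : ℝ≥0) (hi : i ∉ S) : M.totalWeight (Function.update σ i t) S = M.totalWeight σ S :=
  totalWeight_congr fun j hj => Function.update_of_ne (by rintro rfl; exact hi hj) _ _

lemma totalWeight_update_of_mem (σ : Fin K → ℝ≥0) {S : Finset (Fin K)} {i : Fin K}
    (t : ℝ≥0) (hi : i ∈ S) :
    M.totalWeight (Function.update σ i t) S = M.totalWeight σ (S.erase i) + M.weight i t := by
  rw [← totalWeight_erase_add _ hi, totalWeight_update_of_notMem _ _ (Finset.notMem_erase i S),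
    Function.update_self]

lemma net_empty (σ : Fin K → ℝ≥0) : M.net σ ∅ = 0 := by simp [net, totalWeight, gain_zero]

lemma net_update_of_notMem (σ : Fin K → ℝ≥0) {S : Finset (Fin K)} {i : Fin K}
    (t : ℝ≥0) (hi : i ∉ S) : M.net (Function.update σ i t) S = M.net σ S := by
  rw [net, net, totalWeight_update_of_notMem _ _ hi]

lemma marg_eq (σ : Fin K → ℝ≥0) {A : Finset (Fin K)} {i : Fin K} (hi : i ∈ A) :
    M.marg σ A i = gain (M.totalWeight σ (A.erase i) + M.weight i (σ i)) -
      gain (M.totalWeight σ (A.erase i)) := by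
  rw [marg, totalWeight_erase_add _ hi]

lemma marg_update (σ : Fin K → ℝ≥0) {A : Finset (Fin K)} {i : Fin K} (t : ℝ≥0) (hi : i ∈ A) :
    M.marg (Function.update σ i t) A i = gain (M.totalWeight σ (A.erase i) + M.weight i t) -
      gain (M.totalWeight σ (A.erase i)) := by
  rw [marg_eq _ hi, totalWeight_update_of_notMem _ _ (Finset.notMem_erase i A),
    Function.update_self]

lemma marg_nonneg (hM : M.Admissible) (σ : Fin K → ℝ≥0) (A : Finset (Fin K)) (i : Fin K) :
    0 ≤ M.marg σ A i :=
  sub_nonneg.2 (gain_le_gain (totalWeight_nonneg hM _ _)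
    (totalWeight_mono hM σ (Finset.erase_subset _ _)))

/-- Marginal information is smaller in larger coalitions. -/
lemma marg_anti (hM : M.Admissible) (σ : Fin K → ℝ≥0) {A B : Finset (Fin K)} {i : Fin K}
    (hAB : A ⊆ B) (hi : i ∈ A) : M.marg σ B i ≤ M.marg σ A i := by
  rw [marg_eq _ hi, marg_eq _ (hAB hi)]
  exact gain_increment_le (totalWeight_nonneg hM _ _)
    (totalWeight_mono hM σ (Finset.erase_subset_erase i hAB)) (weight_nonneg hM _ _)

lemma net_supermodular (hM : M.Admissible) (hα : 0 < M.α) (σ : Fin K → ℝ≥0)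
    (A B : Finset (Fin K)) :
    M.net σ A + M.net σ B ≤ M.net σ (A ∪ B) + M.net σ (A ∩ B) := by
  have hc : ((A ∪ B).card : ℝ) + (A ∩ B).card = A.card + B.card := by
    exact_mod_cast Finset.card_union_add_card_inter A B
  have hw : M.totalWeight σ (A ∪ B) + M.totalWeight σ (A ∩ B) =
      M.totalWeight σ A + M.totalWeight σ B := Finset.sum_union_inter
  have hA := totalWeight_mono hM σ (Finset.inter_subset_left (s₁ := A) (s₂ := B))
  have hB := totalWeight_mono hM σ (Finset.inter_subset_right (s₁ := A) (s₂ := B))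
  have h0 := totalWeight_nonneg hM σ (A ∩ B)
  have h := gain_increment_le h0 hB (sub_nonneg.2 hA)
  rw [show M.totalWeight σ B + (M.totalWeight σ A - M.totalWeight σ (A ∩ B)) =
      M.totalWeight σ (A ∪ B) by linarith, add_sub_cancel] at h
  unfold net
  nlinarith

lemma exists_bestShare (hM : M.Admissible) (hα : 0 < M.α) (σ : Fin K → ℝ≥0)
    (e : Finset (Fin K)) : ∃ A, M.BestShare σ e A := by
  classical
  let 𝒮 := e.powerset.filter fun A => ∀ T ⊆ e, M.net σ T ≤ M.net σ A
  have hmem : ∀ A, A ∈ 𝒮 ↔ A ⊆ e ∧ ∀ T ⊆ e, M.net σ T ≤ M.net σ A := by simp [𝒮]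
  obtain ⟨A₀, hA₀, hmax⟩ := e.powerset.exists_max_image (M.net σ) ⟨∅, by simp⟩
  have hne : 𝒮.Nonempty :=
    ⟨A₀, (hmem _).2 ⟨by simpa using hA₀, fun T hT => hmax T (by simpa using hT)⟩⟩
  obtain ⟨A, hA, hcard⟩ := 𝒮.exists_max_image Finset.card hne
  rw [hmem] at hA
  refine ⟨A, hA, fun T hT => ?_⟩
  have hU : A ∪ T ∈ 𝒮 := by
    refine (hmem _).2 ⟨Finset.union_subset hA.1 hT.1, fun R hR => ?_⟩
    have h1 := net_supermodular hM hα σ A T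
    have h2 := hA.2 (A ∩ T) (Finset.inter_subset_left.trans hA.1)
    have h3 := hT.2 R hR
    linarith
  have := Finset.eq_of_subset_of_card_le Finset.subset_union_left (hcard _ hU)
  rw [this]
  exact Finset.subset_union_right

lemma bestShare_self {σ : Fin K → ℝ≥0} {e : Finset (Fin K)}
    (h : ∀ T ⊆ e, M.net σ T ≤ M.net σ e) : M.BestShare σ e e :=
  ⟨⟨subset_rfl, h⟩, fun _ hT => hT.1⟩

lemma info_eq (hM : M.Admissible) (σ : Fin K → ℝ≥0) (e a b : Finset (Fin K)) :
    M.info σ e a b = gain (M.totalWeight σ (e ∩ a ∩ b)) :=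
  infoBuyer_eq hM _ _

lemma userUtility_eq_net (hM : M.Admissible) (σ : Fin K → ℝ≥0) {e a b : Finset (Fin K)}
    (h : e ∩ a ⊆ b) : M.userUtility σ e a b = M.net σ (e ∩ a) := by
  rw [userUtility, info_eq hM, Finset.inter_eq_left.2 h,
    Finset.sum_congr rfl fun i _ => infoPlatform_eq_half (hM.norm_x i), net]
  simp [div_eq_mul_inv]

lemma mem_region_iff (hM : M.Admissible) {σ : Fin K → ℝ≥0} {a e : Finset (Fin K)} :
    σ ∈ M.region a e ↔ ∀ T ⊆ e, M.net σ T ≤ M.net σ (e ∩ a) := by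
  change (∀ a', M.userUtility σ e a' univ ≤ M.userUtility σ e a univ) ↔ _
  simp only [userUtility_eq_net hM σ (Finset.subset_univ _)]
  refine ⟨fun h T hT => ?_, fun h a' => h _ Finset.inter_subset_left⟩
  have := h T
  rwa [Finset.inter_eq_right.2 hT] at this

lemma mem_region_univ_iff (hM : M.Admissible) {σ : Fin K → ℝ≥0} {e : Finset (Fin K)} :
    σ ∈ M.region univ e ↔ ∀ T ⊆ e, M.net σ T ≤ M.net σ e := by
  rw [mem_region_iff hM, Finset.inter_univ]

lemma mem_region_empty_iff (hM : M.Admissible) {σ : Fin K → ℝ≥0} {e : Finset (Fin K)} :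
    σ ∈ M.region ∅ e ↔ ∀ T ⊆ e, M.net σ T ≤ 0 := by
  rw [mem_region_iff hM, Finset.inter_empty, net_empty]

lemma marginal_eq_marg (hM : M.Admissible) (σ : Fin K → ℝ≥0) (e : Finset (Fin K)) (i : Fin K) :
    M.marginal σ e i = M.marg σ e i := by
  rw [marginal, info_eq hM, info_eq hM, marg]
  congr 3 <;> ext j <;> simp [and_comm]

lemma net_zero_noise_nonpos (hM : M.Admissible) (T : Finset (Fin K)) :
    M.net (fun _ => 0) T ≤ 0 :=
  (mem_region_empty_iff hM).1 (hM.privacy T) T subset_rfl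

/-- The privacy assumption forces `2α` to exceed the number of platforms, since the information
revealed is below the prior variance one. -/
lemma card_lt_two_mul_alpha (hM : M.Admissible) (hα : 0 < M.α) (T : Finset (Fin K)) :
    (T.card : ℝ) < 2 * M.α := by
  have h := net_zero_noise_nonpos hM T
  have h1 := gain_lt_one (totalWeight_nonneg hM (fun _ => 0) T)
  unfold net at h
  nlinarith

/-- The privacy assumption also forces every platform to be correlated with the buyer. -/
lemma γ_ne_zero (hM : M.Admissible) (i : Fin K) : M.γ i ≠ 0 := by
  intro h
  have := net_zero_noise_nonpos hM {i}
  simp [net, totalWeight, weight, h, gain_zero] at this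
  linarith

lemma weight_pos (hM : M.Admissible) (i : Fin K) (t : ℝ≥0) : 0 < M.weight i t :=
  div_pos (sq_pos_of_ne_zero (γ_ne_zero hM i)) (noise_pos hM i t)

/-- Every weight between zero and the noiseless one is attained. -/
lemma exists_weight_eq (hM : M.Admissible) (i : Fin K) {v : ℝ} (hv : 0 < v)
    (hv' : v ≤ M.weight i 0) : ∃ t, M.weight i t = v := by
  have hn := noise_pos hM i 0
  have hγ : 0 < M.γ i ^ 2 := sq_pos_of_ne_zero (γ_ne_zero hM i)
  simp only [NNReal.coe_zero, ne_eq, OfNat.ofNat_ne_zero, not_false_eq_true, zero_pow,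
    add_zero] at hn
  have h0 : 0 ≤ M.γ i ^ 2 / v - (2 - M.γ i ^ 2) := by
    rw [weight, le_div_iff₀ (by simpa using hn)] at hv'
    rw [sub_nonneg, le_div_iff₀ hv]
    simp only [NNReal.coe_zero, ne_eq, OfNat.ofNat_ne_zero, not_false_eq_true, zero_pow,
      add_zero] at hv'
    linarith
  refine ⟨(Real.sqrt (M.γ i ^ 2 / v - (2 - M.γ i ^ 2))).toNNReal, ?_⟩
  rw [weight, Real.coe_toNNReal _ (Real.sqrt_nonneg _), Real.sq_sqrt h0]
  field_simp
  simp [γ_ne_zero hM i]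

lemma marg_pos (hM : M.Admissible) (σ : Fin K → ℝ≥0) {A : Finset (Fin K)} {i : Fin K}
    (hi : i ∈ A) : 0 < M.marg σ A i := by
  rw [marg_eq _ hi, sub_pos]
  exact gain_lt_gain (totalWeight_nonneg hM _ _) (by linarith [weight_pos hM i (σ i)])

/-- The marginal contributions of the platforms in `A \ B` add up to at most their joint
contribution. -/
lemma sum_marg_le (hM : M.Admissible) (σ : Fin K → ℝ≥0) {A B : Finset (Fin K)} (hBA : B ⊆ A) :
    ∑ i ∈ A \ B, M.marg σ A i ≤ gain (M.totalWeight σ A) - gain (M.totalWeight σ B) := by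
  have hB := totalWeight_nonneg hM σ B
  have hsum : M.totalWeight σ B + ∑ i ∈ A \ B, M.weight i (σ i) = M.totalWeight σ A := by
    rw [add_comm]; exact Finset.sum_sdiff hBA
  have hD : 0 ≤ ∑ i ∈ A \ B, M.weight i (σ i) := Finset.sum_nonneg fun i _ => weight_nonneg hM i _
  rw [← hsum, gain_add_sub_gain hB hD, Finset.sum_div]
  refine Finset.sum_le_sum fun i hi => ?_
  rw [Finset.mem_sdiff] at hi
  have hw := weight_nonneg hM i (σ i)
  have hE := totalWeight_mono hM σ (Finset.subset_erase.2 ⟨hBA, hi.2⟩)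
  have hE' := totalWeight_erase_add (M := M) σ hi.1
  rw [marg_eq _ hi.1, gain_add_sub_gain (hB.trans hE) hw]
  refine div_le_div_of_nonneg_left hw (mul_pos ?_ ?_) (mul_le_mul ?_ ?_ ?_ ?_) <;> linarith

end Market
end DataMarket

/-! ### Prices, purchases and sharing in the subgames -/

namespace DataMarket
namespace Market

variable {K d : ℕ} (M : Market K d)

/-- In every subgame the prices are the marginal values of the offered data, and the buyer buys all
the data on offer. -/
structure Competitive (s : Profile K) : Prop where
  price_eq_zero : ∀ σ e a i, i ∉ e ∩ a → s.price σ e a i = 0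
  price_eq_marg : ∀ σ e a i, i ∈ e ∩ a → s.price σ e a i = M.β * M.marg σ (e ∩ a) i
  buys : ∀ σ e a, e ∩ a ⊆ s.buyerAfter σ e a

/-- The utility of platform `i` if the platforms in `e` enter, the user shares with the entrants in
`A`, and their data is sold at marginal values. -/
noncomputable def payoff (i : Fin K) (σ : Fin K → ℝ≥0) (e A : Finset (Fin K)) : ℝ :=
  if i ∈ e then (if i ∈ A then 1 / 2 + M.β * M.marg σ A i else 0) - M.c i else 0

/-- No platform gains by changing its noise level and entry decision, if the user then plays her
greatest best reply and data is sold at marginal values. -/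
def EntryEquilibrium (σ : Fin K → ℝ≥0) (e : Finset (Fin K)) : Prop :=
  ∀ (i : Fin K) (t : ℝ≥0) (e' : Finset (Fin K)), (∀ j, j ≠ i → (j ∈ e' ↔ j ∈ e)) →
    ∀ A A', M.BestShare σ e A → M.BestShare (Function.update σ i t) e' A' →
      M.payoff i (Function.update σ i t) e' A' ≤ M.payoff i σ e A

variable {M}

lemma buyerUtility_insert_sub (hM : M.Admissible) (σ : Fin K → ℝ≥0) {e a b : Finset (Fin K)}
    (p : Fin K → ℝ) {i : Fin K} (hi : i ∈ e ∩ a) (hib : i ∉ b) :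
    M.buyerUtility σ e a p (insert i b) - M.buyerUtility σ e a p b =
      M.β * M.marg σ (insert i (e ∩ a ∩ b)) i - p i := by
  have hib' : i ∉ e ∩ a ∩ b := fun h => hib (Finset.mem_inter.1 h).2
  rw [buyerUtility, buyerUtility, info_eq hM, info_eq hM, Finset.sum_insert hib,
    Finset.inter_insert_of_mem hi, marg, Finset.erase_insert hib']
  ring

/-- A buyer who replies optimally accepts every price below the marginal value: information is
submodular, so the offer is worth at least this much to her whatever else she buys. -/
lemma mem_buyer_of_lt (hM : M.Admissible) {s : Profile K} (hb : M.BuyerOptimal s)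
    (σ : Fin K → ℝ≥0) {e a : Finset (Fin K)} (p : Fin K → ℝ) {i : Fin K} (hi : i ∈ e ∩ a)
    (hp : p i < M.β * M.marg σ (e ∩ a) i) : i ∈ s.buyer σ e a p := by
  by_contra hib
  have h1 := hb σ e a p (insert i (s.buyer σ e a p))
  have h2 := buyerUtility_insert_sub hM σ p hi hib
  have h3 : M.marg σ (e ∩ a) i ≤ M.marg σ (insert i (e ∩ a ∩ s.buyer σ e a p)) i :=
    marg_anti hM σ (Finset.insert_subset hi Finset.inter_subset_left) (Finset.mem_insert_self _ _)
  have h4 := mul_le_mul_of_nonneg_left h3 hM.β_pos.le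
  linarith

lemma platformUtility_of_mem {i : Fin K} {e a : Finset (Fin K)} (hi : i ∈ e ∩ a)
    (p : Fin K → ℝ) (b : Finset (Fin K)) :
    M.platformUtility i e a p b =
      infoPlatform M.x i + (if i ∈ b then p i else 0) - M.c i := by
  rw [Finset.mem_inter] at hi
  simp [platformUtility, hi.1, hi.2]

/-- By undercutting the marginal value a platform sells, so its revenue is at least the marginal
value; and the buyer never pays more. -/
theorem IsEquilibrium.competitive (hM : M.Admissible) {s : Profile K} (hs : M.IsEquilibrium s) :
    M.Competitive s := by
  have hrev : ∀ σ e a i, i ∈ e ∩ a → ∀ q < M.β * M.marg σ (e ∩ a) i,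
      q ≤ if i ∈ s.buyerAfter σ e a then s.price σ e a i else 0 := by
    intro σ e a i hi q hq
    have h1 := (hs.price σ e a).2 i hi q
    have h2 := mem_buyer_of_lt hM hs.buyer σ (Function.update (s.price σ e a) i q) hi (by simpa)
    rw [platformUtility_of_mem hi, platformUtility_of_mem hi, if_pos h2,
      Function.update_self] at h1
    linarith
  have hrev' : ∀ σ e a i, i ∈ e ∩ a → M.β * M.marg σ (e ∩ a) i ≤
      if i ∈ s.buyerAfter σ e a then s.price σ e a i else 0 := fun σ e a i hi =>
    le_of_forall_lt_imp_le_of_dense (hrev σ e a i hi)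
  have hbuys : ∀ σ e a, e ∩ a ⊆ s.buyerAfter σ e a := by
    intro σ e a i hi
    by_contra hib
    have := hrev' σ e a i hi
    rw [if_neg hib] at this
    exact this.not_gt (mul_pos hM.β_pos (marg_pos hM σ hi))
  refine ⟨fun σ e a => (hs.price σ e a).1, fun σ e a i hi => ?_, hbuys⟩
  refine le_antisymm ?_ ?_
  · have hib := hbuys σ e a hi
    have h1 := hs.buyer σ e a (s.price σ e a) ((s.buyerAfter σ e a).erase i)
    have h2 := buyerUtility_insert_sub hM σ (s.price σ e a) hi
      (Finset.notMem_erase i (s.buyerAfter σ e a))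
    rw [Finset.insert_erase hib, Finset.inter_erase, Finset.inter_eq_left.2 (hbuys σ e a),
      Finset.insert_erase hi] at h2
    change _ ≤ M.buyerUtility σ e a _ (s.buyerAfter σ e a) at h1
    linarith
  · simpa [hbuys σ e a hi] using hrev' σ e a i hi

namespace Competitive

variable {s : Profile K}

lemma userUtility_eq (hM : M.Admissible) (hs : M.Competitive s) (σ : Fin K → ℝ≥0)
    (e a : Finset (Fin K)) : M.userUtility σ e a (s.buyerAfter σ e a) = M.net σ (e ∩ a) :=
  userUtility_eq_net hM σ (hs.buys σ e a)

/-- The user's greatest best reply serves the entrants of `BestShare`; platforms that have not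
entered are irrelevant to her and belong to it as well. -/
lemma userOptimal_iff (hM : M.Admissible) (hs : M.Competitive s) :
    M.UserOptimal s ↔ ∀ σ e, M.BestShare σ e (e ∩ s.user σ e) ∧ eᶜ ⊆ s.user σ e := by
  unfold UserOptimal
  simp only [userUtility_eq hM hs]
  refine forall_congr' fun σ => forall_congr' fun e => ⟨fun h => ?_, fun h => ?_⟩
  · have hbest : ∀ T ⊆ e, M.net σ T ≤ M.net σ (e ∩ s.user σ e) := fun T hT => by
      simpa [Finset.inter_eq_right.2 hT] using h.1 T
    refine ⟨⟨⟨Finset.inter_subset_left, hbest⟩, fun T hT => ?_⟩, ?_⟩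
    · refine Finset.subset_inter hT.1 (h.2 fun a' => ?_)
      rw [Finset.inter_eq_right.2 hT.1]
      exact hT.2 _ Finset.inter_subset_left
    · have : s.user σ e ∪ eᶜ ≤ s.user σ e := h.2 fun a' => by
        have : e ∩ (s.user σ e ∪ eᶜ) = e ∩ s.user σ e := by
          rw [Finset.inter_union_distrib_left]; simp
        rw [this]
        exact h.1 a'
      exact Finset.subset_union_right.trans this
  · refine ⟨fun a' => h.1.1.2 _ Finset.inter_subset_left, fun T hT j hj => ?_⟩
    by_cases hje : j ∈ e
    · have hmem : e ∩ T ∈ {A | A ⊆ e ∧ ∀ R ⊆ e, M.net σ R ≤ M.net σ A} :=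
        ⟨Finset.inter_subset_left, fun R hR => by
          simpa [Finset.inter_eq_right.2 hR] using hT R⟩
      have := h.1.2 hmem
      exact Finset.mem_of_mem_inter_right (this (Finset.mem_inter.2 ⟨hje, hj⟩))
    · exact h.2 (Finset.mem_compl.2 hje)

lemma platformValue_eq (hM : M.Admissible) (hs : M.Competitive s) (i : Fin K)
    (σ : Fin K → ℝ≥0) (e : Finset (Fin K)) :
    M.platformValue s i σ e = M.payoff i σ e (e ∩ s.user σ e) := by
  by_cases hi : i ∈ e
  · by_cases ha : i ∈ s.user σ e
    · have hia := Finset.mem_inter.2 ⟨hi, ha⟩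
      rw [platformValue, platformUtility_of_mem hia, if_pos (hs.buys σ e _ hia),
        hs.price_eq_marg σ e _ i hia, infoPlatform_eq_half (hM.norm_x i), payoff, if_pos hi,
        if_pos hia]
    · have := hs.price_eq_zero σ e (s.user σ e) i (by simp [ha])
      simp [platformValue, platformUtility, payoff, hi, ha, this]
  · simp [platformValue, platformUtility, payoff, hi]

lemma platformEquilibrium_iff (hM : M.Admissible) (hs : M.Competitive s) (hu : M.UserOptimal s) :
    M.PlatformEquilibrium s ↔ M.EntryEquilibrium s.σ s.e := by
  rw [userOptimal_iff hM hs] at hu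
  unfold PlatformEquilibrium EntryEquilibrium
  simp only [platformValue_eq hM hs]
  refine forall_congr' fun i => forall_congr' fun t => forall_congr' fun e' =>
    forall_congr' fun _ => ⟨fun h A A' hA hA' => ?_, fun h => h _ _ (hu _ _).1 (hu _ _).1⟩
  rwa [hA.unique (hu _ _).1, hA'.unique (hu _ _).1]

/-- Prices are transfers, so they cancel in the welfare. -/
lemma welfare_eq (hM : M.Admissible) (hs : M.Competitive s)
    (hA : s.e ∩ s.user s.σ s.e = s.e) :
    M.welfare s = ∑ i ∈ s.e, (1 / 2 - M.c i) + M.net s.σ s.e +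
      M.β * gain (M.totalWeight s.σ s.e) := by
  have hp : ∑ i ∈ s.buyerAfter s.σ s.e (s.user s.σ s.e), s.price s.σ s.e (s.user s.σ s.e) i =
      ∑ i ∈ s.e, s.price s.σ s.e (s.user s.σ s.e) i := by
    refine (Finset.sum_subset ?_ fun i _ hi => ?_).symm
    · have := hs.buys s.σ s.e (s.user s.σ s.e)
      rwa [hA] at this
    · exact hs.price_eq_zero _ _ _ _ (by rwa [hA])
  have hv : ∑ i, M.platformValue s i s.σ s.e =
      ∑ i ∈ s.e, (1 / 2 + s.price s.σ s.e (s.user s.σ s.e) i - M.c i) := by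
    rw [← Finset.sum_subset (Finset.subset_univ s.e) fun i _ hi => by
      rw [platformValue_eq hM hs, payoff, if_neg hi]]
    refine Finset.sum_congr rfl fun i hi => ?_
    rw [platformValue_eq hM hs, payoff, hA, if_pos hi, if_pos hi,
      hs.price_eq_marg _ _ _ _ (by rwa [hA]), hA]
  have hb := hs.buys s.σ s.e (s.user s.σ s.e)
  change ∑ i, M.platformValue s i s.σ s.e +
    M.userUtility s.σ s.e _ (s.buyerAfter s.σ s.e (s.user s.σ s.e)) +
    M.buyerUtility s.σ s.e _ _ (s.buyerAfter s.σ s.e (s.user s.σ s.e)) = _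
  rw [hv, userUtility_eq hM hs, buyerUtility, hp, info_eq hM, Finset.inter_eq_left.2 hb, hA]
  simp only [Finset.sum_sub_distrib, Finset.sum_add_distrib]
  ring

end Competitive

/-- The prices at marginal values. -/
noncomputable def margPrice (M : Market K d) (σ : Fin K → ℝ≥0) (e a : Finset (Fin K))
    (i : Fin K) : ℝ :=
  if i ∈ e ∩ a then M.β * M.marg σ (e ∩ a) i else 0

lemma sum_margPrice (σ : Fin K → ℝ≥0) (e a b : Finset (Fin K)) :
    ∑ i ∈ b, M.margPrice σ e a i = ∑ i ∈ e ∩ a ∩ b, M.β * M.marg σ (e ∩ a) i := by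
  simp only [margPrice]
  rw [← Finset.sum_filter, Finset.filter_mem_eq_inter, Finset.inter_comm]

/-- At marginal values buying everything is optimal, again by submodularity. -/
lemma buyerUtility_margPrice_le (hM : M.Admissible) (σ : Fin K → ℝ≥0) (e a b : Finset (Fin K)) :
    M.buyerUtility σ e a (M.margPrice σ e a) b ≤
      M.buyerUtility σ e a (M.margPrice σ e a) (e ∩ a) := by
  have h := sum_marg_le hM σ (Finset.inter_subset_left (s₁ := e ∩ a) (s₂ := b))
  have h' := Finset.sum_sdiff (f := fun i => M.β * M.marg σ (e ∩ a) i)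
    (Finset.inter_subset_left (s₁ := e ∩ a) (s₂ := b))
  rw [← Finset.mul_sum] at h'
  rw [buyerUtility, buyerUtility, sum_margPrice, sum_margPrice, info_eq hM, info_eq hM,
    Finset.inter_self]
  nlinarith [mul_le_mul_of_nonneg_left h hM.β_pos.le]

lemma buyerUtility_margPrice_erase (hM : M.Admissible) (σ : Fin K → ℝ≥0)
    {e a : Finset (Fin K)} {i : Fin K} (hi : i ∈ e ∩ a) :
    M.buyerUtility σ e a (M.margPrice σ e a) ((e ∩ a).erase i) =
      M.buyerUtility σ e a (M.margPrice σ e a) (e ∩ a) := by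
  have h := buyerUtility_insert_sub hM σ (M.margPrice σ e a) hi (Finset.notMem_erase i (e ∩ a))
  rw [Finset.insert_erase hi, Finset.inter_eq_right.2 (Finset.erase_subset _ _),
    Finset.insert_erase hi, margPrice, if_pos hi, sub_self] at h
  linarith

lemma buyerUtility_update (σ : Fin K → ℝ≥0) (e a b : Finset (Fin K)) (p : Fin K → ℝ)
    (i : Fin K) (q : ℝ) :
    M.buyerUtility σ e a (Function.update p i q) b =
      M.buyerUtility σ e a p b - if i ∈ b then q - p i else 0 := by
  have h : ∀ j, Function.update p i q j = p j + if j = i then q - p i else 0 := by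
    intro j
    by_cases hj : j = i
    · subst hj; simp
    · simp [hj]
  simp only [buyerUtility, h, Finset.sum_add_distrib, Finset.sum_ite_eq']
  ring

/-- Every equilibrium of the entry game extends to an equilibrium of the market: the user plays her
greatest best reply, prices are marginal values, and the buyer buys everything at these prices and
replies optimally to all others. -/
theorem EntryEquilibrium.exists_isEquilibrium (hM : M.Admissible) (hα : 0 < M.α)
    {σ₀ : Fin K → ℝ≥0} {e₀ : Finset (Fin K)} (h : M.EntryEquilibrium σ₀ e₀) :
    ∃ s, M.IsEquilibrium s := by
  classical
  choose share hshare using exists_bestShare hM hα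
  have hreply : ∀ σ e a p, ∃ b, ∀ b', M.buyerUtility σ e a p b' ≤ M.buyerUtility σ e a p b :=
    fun σ e a p => Finite.exists_max (M.buyerUtility σ e a p)
  choose reply hreply using hreply
  let s : Profile K :=
    { σ := σ₀
      e := e₀
      user := fun σ e => share σ e ∪ eᶜ
      price := M.margPrice
      buyer := fun σ e a p => if p = M.margPrice σ e a then e ∩ a else reply σ e a p }
  have hafter : ∀ σ e a, s.buyerAfter σ e a = e ∩ a := fun σ e a => if_pos rfl
  have hbuyer : M.BuyerOptimal s := by
    intro σ e a p b
    by_cases hp : p = M.margPrice σ e a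
    · subst hp
      simpa [s] using buyerUtility_margPrice_le hM σ e a b
    · simpa [s, hp] using hreply σ e a p b
  have hcomp : M.Competitive s :=
    ⟨fun σ e a i hi => if_neg hi, fun σ e a i hi => if_pos hi, fun σ e a => (hafter σ e a).ge⟩
  have huser : M.UserOptimal s := by
    rw [hcomp.userOptimal_iff hM]
    intro σ e
    have : e ∩ s.user σ e = share σ e := by
      change e ∩ (share σ e ∪ eᶜ) = _
      rw [Finset.inter_union_distrib_left, Finset.inter_compl, Finset.union_empty,
        Finset.inter_eq_right.2 (hshare σ e).1.1]
    rw [this]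
    exact ⟨hshare σ e, Finset.subset_union_right⟩
  refine ⟨s, hbuyer, fun σ e a => ⟨hcomp.price_eq_zero σ e a, fun i hi q => ?_⟩, huser,
    (hcomp.platformEquilibrium_iff hM huser).2 h⟩
  set p := Function.update (s.price σ e a) i q with hp
  have hprice : s.price σ e a = M.margPrice σ e a := rfl
  rw [platformUtility_of_mem hi, platformUtility_of_mem hi, hafter, if_pos hi]
  have hp0 : 0 ≤ s.price σ e a i := by
    rw [hcomp.price_eq_marg σ e a i hi]
    exact mul_nonneg hM.β_pos.le (marg_nonneg hM _ _ _)
  split_ifs with hb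
  · -- at a price above the marginal value, buying from all the others is strictly better
    have h1 := hbuyer σ e a p ((e ∩ a).erase i)
    rw [hp, buyerUtility_update, buyerUtility_update, ← hp, if_pos hb,
      if_neg (Finset.notMem_erase _ _), hprice, buyerUtility_margPrice_erase hM σ hi] at h1
    have h2 := buyerUtility_margPrice_le hM σ e a (s.buyer σ e a p)
    have hpi : p i = q := Function.update_self ..
    rw [hprice, hpi]
    linarith
  · linarith

end Market
end DataMarket

/-! ### Tight sets of weights -/

namespace DataMarket

/-- Weights above a set function on the subsets of `E` can be lowered on `U`, one coordinate after
the other, until each coordinate in `U` belongs to a tight set. -/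
lemma exists_tight_weights {ι : Type*} [DecidableEq ι] (E : Finset ι) (f : Finset ι → ℝ)
    (w₀ : ι → ℝ) (h₀ : ∀ T ⊆ E, f T ≤ ∑ k ∈ T, w₀ k) (U : Finset ι) (hU : U ⊆ E) :
    ∃ w : ι → ℝ, (∀ k, w k ≤ w₀ k) ∧ (∀ k ∉ U, w k = w₀ k) ∧
      (∀ T ⊆ E, f T ≤ ∑ k ∈ T, w k) ∧ ∀ j ∈ U, ∃ T ⊆ E, j ∈ T ∧ ∑ k ∈ T, w k = f T := by
  induction U using Finset.induction_on with
  | empty => exact ⟨w₀, fun _ => le_rfl, fun _ _ => rfl, h₀, by simp⟩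
  | insert j U hj ih =>
    rw [Finset.insert_subset_iff] at hU
    obtain ⟨w, hle, hout, hf, htight⟩ := ih hU.2
    obtain ⟨T₀, hT₀, hmin⟩ := (E.powerset.filter (j ∈ ·)).exists_min_image
      (fun T => ∑ k ∈ T, w k - f T) ⟨E, by simp [hU.1]⟩
    simp only [Finset.mem_filter, Finset.mem_powerset] at hT₀ hmin
    -- the smallest slack of a constraint that involves `j`
    set δ := ∑ k ∈ T₀, w k - f T₀ with hδ
    have hδ0 : 0 ≤ δ := sub_nonneg.2 (hf T₀ hT₀.1)
    have hsum : ∀ T : Finset ι, ∑ k ∈ T, (w k - if k = j then δ else 0) =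
        ∑ k ∈ T, w k - if j ∈ T then δ else 0 := fun T => by
      rw [Finset.sum_sub_distrib, Finset.sum_ite_eq']
    refine ⟨fun k => w k - if k = j then δ else 0, fun k => ?_, fun k hk => ?_, fun T hT => ?_,
      fun k hk => ?_⟩
    · have := hle k
      dsimp only
      split_ifs <;> linarith
    · rw [Finset.mem_insert, not_or] at hk
      simp [hk.1, hout k hk.2]
    · rw [hsum]
      split_ifs with hjT
      · linarith [hmin T ⟨hT, hjT⟩]
      · linarith [hf T hT]
    · rcases Finset.mem_insert.1 hk with rfl | hkU
      · exact ⟨T₀, hT₀.1, hT₀.2, by rw [hsum, if_pos hT₀.2]; linarith⟩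
      · obtain ⟨T, hT, hkT, hTf⟩ := htight k hkU
        refine ⟨T, hT, hkT, ?_⟩
        rw [hsum]
        split_ifs with hjT
        · linarith [hmin T ⟨hT, hjT⟩]
        · linarith

namespace Market

variable {K d : ℕ} {M : Market K d}

/-! ### Thresholds -/

lemma div_marg_le_betaBar (hM : M.Admissible) {i : Fin K} {e : Finset (Fin K)} (hi : i ∈ e)
    {σ : Fin K → ℝ≥0} (h1 : σ ∈ M.region univ e) (h0 : σ ∈ M.region ∅ e) :
    (((M.c i - 1 / 2) / M.marg σ e i : ℝ) : EReal) ≤ M.betaBar := by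
  rw [← marginal_eq_marg hM]
  exact le_iSup_of_le i (le_iSup_of_le e (le_iSup_of_le hi (le_iSup_of_le σ
    (le_iSup_of_le ⟨h1, h0⟩ le_rfl))))

lemma HighBeta.cost_sub_half_le (hM : M.Admissible) (hβ : M.HighBeta) {i : Fin K}
    {e : Finset (Fin K)} (hi : i ∈ e) {σ : Fin K → ℝ≥0} (h1 : σ ∈ M.region univ e)
    (h0 : σ ∈ M.region ∅ e) : M.c i - 1 / 2 ≤ M.β * M.marg σ e i := by
  have := (div_marg_le_betaBar hM hi h1 h0).trans hβ
  rwa [EReal.coe_le_coe_iff, div_le_iff₀ (marg_pos hM σ hi)] at this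

lemma LowBeta.le_cost_sub_half (hM : M.Admissible) (hβ : M.LowBeta) {i : Fin K}
    (hc : 1 / 2 < M.c i) {e : Finset (Fin K)} (hi : i ∈ e) {σ : Fin K → ℝ≥0}
    (h1 : σ ∈ M.region univ e) : M.β * M.marg σ e i ≤ M.c i - 1 / 2 := by
  have h : M.betaUnder ≤ (((M.c i - 1 / 2) / M.marg σ e i : ℝ) : EReal) := by
    rw [← marginal_eq_marg hM]
    exact iInf_le_of_le i (iInf_le_of_le hc (iInf_le_of_le e (iInf_le_of_le hi (iInf_le_of_le σ
      (iInf_le_of_le h1 le_rfl)))))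
  have := hβ.2.trans h
  rwa [EReal.coe_le_coe_iff, le_div_iff₀ (marg_pos hM σ hi)] at this

/-- The precision that reveals the information `n / (2α)`, at which the user is indifferent between
sharing with `n` platforms and with nobody. -/
noncomputable def threshold (M : Market K d) (n : ℝ) : ℝ :=
  n / (2 * M.α) / (1 - n / (2 * M.α))

lemma threshold_nonneg (hα : 0 < M.α) {n : ℝ} (hn0 : 0 ≤ n) (hn : n < 2 * M.α) :
    0 ≤ M.threshold n := by
  have : n / (2 * M.α) < 1 := (div_lt_one (by linarith)).2 hn
  exact div_nonneg (by positivity) (by linarith)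

lemma gain_threshold (hα : 0 < M.α) {n : ℝ} (hn : n < 2 * M.α) :
    gain (M.threshold n) = n / (2 * M.α) :=
  gain_div_one_sub ((div_lt_one (by linarith)).2 hn)

lemma net_eq_mul_sub (hα : 0 < M.α) (σ : Fin K → ℝ≥0) {T : Finset (Fin K)} :
    M.net σ T = M.α * (T.card / (2 * M.α) - gain (M.totalWeight σ T)) := by
  unfold net
  field_simp

lemma net_nonpos_iff (hM : M.Admissible) (hα : 0 < M.α) (σ : Fin K → ℝ≥0) (T : Finset (Fin K)) :
    M.net σ T ≤ 0 ↔ M.threshold T.card ≤ M.totalWeight σ T := by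
  have hT := card_lt_two_mul_alpha hM hα T
  rw [← gain_le_gain_iff (threshold_nonneg hα (by positivity) hT) (totalWeight_nonneg hM σ T),
    gain_threshold hα hT, net_eq_mul_sub hα]
  constructor <;> intro h <;> nlinarith

lemma net_nonneg_iff (hM : M.Admissible) (hα : 0 < M.α) (σ : Fin K → ℝ≥0) (T : Finset (Fin K)) :
    0 ≤ M.net σ T ↔ M.totalWeight σ T ≤ M.threshold T.card := by
  have hT := card_lt_two_mul_alpha hM hα T
  rw [← gain_le_gain_iff (totalWeight_nonneg hM σ T) (threshold_nonneg hα (by positivity) hT),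
    gain_threshold hα hT, net_eq_mul_sub hα]
  constructor <;> intro h <;> nlinarith

lemma net_eq_zero_iff (hM : M.Admissible) (hα : 0 < M.α) (σ : Fin K → ℝ≥0) (T : Finset (Fin K)) :
    M.net σ T = 0 ↔ M.totalWeight σ T = M.threshold T.card := by
  rw [le_antisymm_iff, le_antisymm_iff, net_nonpos_iff hM hα, net_nonneg_iff hM hα, and_comm]

/-- A single platform can keep the user indifferent, and its marginal information is then
`1 / (2α)`. -/
lemma exists_indifferent_singleton (hM : M.Admissible) (hα : 0 < M.α) (i : Fin K) :
    ∃ σ ∈ M.region univ {i} ∩ M.region ∅ {i}, M.marg σ {i} i = 1 / (2 * M.α) := by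
  have h1 : (1 : ℝ) < 2 * M.α := by simpa using card_lt_two_mul_alpha hM hα {i}
  have h0 := (net_nonpos_iff hM hα _ _).1 (net_zero_noise_nonpos hM {i})
  have hpos : 0 < M.threshold 1 := by
    have : 1 / (2 * M.α) < 1 := (div_lt_one (by linarith)).2 h1
    exact div_pos (by positivity) (by linarith)
  obtain ⟨t, ht⟩ := exists_weight_eq hM i hpos (by simpa [totalWeight] using h0)
  have hw : M.totalWeight (fun _ => t) {i} = M.threshold 1 := by simpa [totalWeight] using ht
  have hnet : M.net (fun _ => t) {i} = 0 := by
    rw [net_eq_zero_iff hM hα, hw]; simp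
  have hall : ∀ T ⊆ ({i} : Finset (Fin K)), M.net (fun _ => t) T ≤ 0 := by
    intro T hT
    rcases Finset.subset_singleton_iff.1 hT with rfl | rfl
    · rw [net_empty]
    · rw [hnet]
  refine ⟨fun _ => t, ⟨(mem_region_univ_iff hM).2 (by rwa [hnet]),
    (mem_region_empty_iff hM).2 hall⟩, ?_⟩
  rw [marg, hw, gain_threshold hα h1]
  simp [totalWeight, gain_zero]

lemma HighBeta.cost_le (hM : M.Admissible) (hα : 0 < M.α) (hβ : M.HighBeta) (i : Fin K) :
    M.c i ≤ 1 / 2 + M.β / (2 * M.α) := by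
  obtain ⟨σ, hσ, hm⟩ := exists_indifferent_singleton hM hα i
  have := hβ.cost_sub_half_le hM (Finset.mem_singleton_self i) hσ.1 hσ.2
  rw [hm, mul_one_div] at this
  linarith

lemma cost_lt_of_betaBar_lt (hM : M.Admissible) (hα : 0 < M.α) (hβ : M.betaBar < (M.β : EReal))
    (i : Fin K) : M.c i < 1 / 2 + M.β / (2 * M.α) := by
  obtain ⟨σ, hσ, hm⟩ := exists_indifferent_singleton hM hα i
  have := (div_marg_le_betaBar hM (Finset.mem_singleton_self i) hσ.1 hσ.2).trans_lt hβ
  rw [EReal.coe_lt_coe_iff, div_lt_iff₀ (marg_pos hM σ (Finset.mem_singleton_self i)), hm,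
    mul_one_div] at this
  linarith

lemma LowBeta.le_cost (hM : M.Admissible) (hα : 0 < M.α) (hβ : M.LowBeta) {i : Fin K}
    (hc : 1 / 2 < M.c i) : 1 / 2 + M.β / (2 * M.α) ≤ M.c i := by
  obtain ⟨σ, hσ, hm⟩ := exists_indifferent_singleton hM hα i
  have := hβ.le_cost_sub_half hM hc (Finset.mem_singleton_self i) hσ.1
  rw [hm, mul_one_div] at this
  linarith

/-- There are noise levels at which the user never gains from sharing within `E`, platform `i` adds
no noise, and the user is indifferent to sharing with all the other platforms in `E` and possibly
platform `i`. By supermodularity the greatest of her best replies contains all tight sets. -/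
lemma exists_indifferent_of_noiseless (hM : M.Admissible) (hα : 0 < M.α) (E : Finset (Fin K))
    (i : Fin K) : ∃ σ ∈ M.region ∅ E, M.weight i (σ i) = M.weight i 0 ∧
      ∃ A ⊆ E, E.erase i ⊆ A ∧ M.net σ A = 0 := by
  obtain ⟨w, hle, hout, hf, htight⟩ := exists_tight_weights E (fun T => M.threshold T.card)
    (fun k => M.weight k 0)
    (fun T _ => (net_nonpos_iff hM hα _ _).1 (net_zero_noise_nonpos hM T)) (E.erase i)
    (Finset.erase_subset _ _)
  have hex : ∀ k, ∃ t, M.weight k t = w k := by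
    intro k
    refine exists_weight_eq hM k ?_ (hle k)
    by_cases hk : k ∈ E
    · have h1 : (1 : ℝ) < 2 * M.α := by simpa using card_lt_two_mul_alpha hM hα {k}
      have : 1 / (2 * M.α) < 1 := (div_lt_one (by linarith)).2 h1
      have hpos : 0 < M.threshold 1 := div_pos (by positivity) (by linarith)
      have := hf {k} (Finset.singleton_subset_iff.2 hk)
      simp only [Finset.card_singleton, Nat.cast_one, Finset.sum_singleton] at this
      linarith
    · rw [hout k fun h => hk (Finset.mem_of_mem_erase h)]
      exact weight_pos hM k 0
  choose σ hσ using hex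
  have hW : ∀ T, M.totalWeight σ T = ∑ k ∈ T, w k := fun T =>
    Finset.sum_congr rfl fun k _ => hσ k
  have hnonpos : ∀ T ⊆ E, M.net σ T ≤ 0 := fun T hT => by
    rw [net_nonpos_iff hM hα, hW]; exact hf T hT
  obtain ⟨A, hA⟩ := exists_bestShare hM hα σ E
  have hA0 : M.net σ A = 0 := le_antisymm (hnonpos A hA.1.1)
    (by simpa [net_empty] using hA.1.2 ∅ (Finset.empty_subset _))
  refine ⟨σ, (mem_region_empty_iff hM).2 hnonpos,
    by rw [hσ, hout i (Finset.notMem_erase i E)], A, hA.1.1, fun j hj => ?_, hA0⟩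
  obtain ⟨T, hT, hjT, hTf⟩ := htight j hj
  have hT0 : M.net σ T = 0 := by rw [net_eq_zero_iff hM hα, hW, hTf]
  have hmem : T ∈ {A | A ⊆ E ∧ ∀ R ⊆ E, M.net σ R ≤ M.net σ A} :=
    ⟨hT, fun R hR => by rw [hT0]; exact hnonpos R hR⟩
  exact hA.2 hmem hjT

/-! ### Equilibria of the entry game -/

lemma weight_lt_weight_zero (hM : M.Admissible) (i : Fin K) {t : ℝ≥0} (ht : t ≠ 0) :
    M.weight i t < M.weight i 0 := by
  have h := noise_pos hM i 0
  unfold weight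
  refine div_lt_div_of_pos_left (sq_pos_of_ne_zero (γ_ne_zero hM i)) h ?_
  have : 0 < (t : ℝ) := NNReal.coe_pos.2 (pos_iff_ne_zero.2 ht)
  simpa using pow_pos this 2

/-- By adding enough noise an entrant makes sure that the user shares with it. -/
lemma exists_noise_mem_bestShare (hM : M.Admissible) (hα : 0 < M.α) (i : Fin K) :
    ∃ t, ∀ (σ : Fin K → ℝ≥0) (e A : Finset (Fin K)), i ∈ e →
      M.BestShare (Function.update σ i t) e A → i ∈ A := by
  obtain ⟨t, ht⟩ := exists_weight_eq hM i (v := min (M.weight i 0) (1 / (4 * M.α)))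
    (lt_min (weight_pos hM i 0) (by positivity)) (min_le_left _ _)
  refine ⟨t, fun σ e A hi hA => ?_⟩
  by_contra hiA
  have h1 := hA.1.2 (insert i A) (Finset.insert_subset hi hA.1.1)
  have h2 := gain_add_sub_gain_le (totalWeight_nonneg hM (Function.update σ i t) A)
    (weight_nonneg hM i t)
  have h3 : M.weight i t ≤ 1 / (4 * M.α) := ht ▸ min_le_right _ _
  rw [le_div_iff₀ (by positivity)] at h3
  rw [net, net, totalWeight_insert _ hiA, Finset.card_insert_of_notMem hiA, Function.update_self]
    at h1
  push_cast at h1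
  nlinarith

/-- If the user is indifferent between sharing with all of `e` and with nobody, and still does not
lose from sharing with one more entrant, then she shares with all of them. -/
lemma bestShare_insert (hM : M.Admissible) (hα : 0 < M.α) {σ : Fin K → ℝ≥0}
    {e : Finset (Fin K)} (he : ∀ T ⊆ e, M.net σ T ≤ 0) (he0 : M.net σ e = 0) {i : Fin K}
    (hi : i ∉ e) {t : ℝ≥0} (h : 0 ≤ M.net (Function.update σ i t) (insert i e)) :
    M.BestShare (Function.update σ i t) (insert i e) (insert i e) := by
  refine bestShare_self fun T hT => ?_
  have h1 := net_supermodular hM hα (Function.update σ i t) T e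
  rw [net_update_of_notMem σ t hi, he0,
    net_update_of_notMem σ t fun h => hi (Finset.mem_of_mem_inter_right h)] at h1
  have h2 := he _ (Finset.inter_subset_right (s₁ := T) (s₂ := e))
  by_cases hiT : i ∈ T
  · have hU : T ∪ e = insert i e :=
      (Finset.union_subset hT (Finset.subset_insert _ _)).antisymm
        (Finset.insert_subset (Finset.mem_union_left _ hiT) Finset.subset_union_right)
    rw [hU] at h1
    linarith
  · rw [net_update_of_notMem σ t hiT]
    exact (he T ((Finset.subset_insert_iff_of_notMem hiT).1 hT)).trans h

lemma payoff_of_mem {i : Fin K} {σ : Fin K → ℝ≥0} {e A : Finset (Fin K)} (he : i ∈ e)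
    (hA : i ∈ A) : M.payoff i σ e A = 1 / 2 + M.β * M.marg σ A i - M.c i := by
  rw [payoff, if_pos he, if_pos hA]

lemma payoff_of_notMem_share {i : Fin K} {σ : Fin K → ℝ≥0} {e A : Finset (Fin K)} (he : i ∈ e)
    (hA : i ∉ A) : M.payoff i σ e A = - M.c i := by
  rw [payoff, if_pos he, if_neg hA, zero_sub]

lemma payoff_of_notMem {i : Fin K} {σ : Fin K → ℝ≥0} {e A : Finset (Fin K)} (he : i ∉ e) :
    M.payoff i σ e A = 0 := if_neg he

namespace EntryEquilibrium

variable {σ : Fin K → ℝ≥0} {e : Finset (Fin K)}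

/-- In equilibrium the user shares with all entrants. -/
lemma bestShare (hM : M.Admissible) (hα : 0 < M.α) (h : M.EntryEquilibrium σ e) :
    M.BestShare σ e e := by
  obtain ⟨A, hA⟩ := exists_bestShare hM hα σ e
  suffices hsub : e ⊆ A by
    have heq := hsub.antisymm hA.1.1
    subst heq
    exact hA
  intro i hi
  by_contra hiA
  obtain ⟨t, ht⟩ := exists_noise_mem_bestShare hM hα i
  obtain ⟨A', hA'⟩ := exists_bestShare hM hα (Function.update σ i t) e
  have h1 := h i t e (fun _ _ => Iff.rfl) A A' hA hA'
  rw [payoff_of_mem hi (ht σ e A' hi hA'), payoff_of_notMem_share hi hiA] at h1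
  have := mul_nonneg hM.β_pos.le (marg_nonneg hM (Function.update σ i t) A' i)
  linarith

/-- A platform that adds noise would add slightly less, unless the user is about to drop it. -/
lemma exists_net_eq_of_noise_ne_zero (hM : M.Admissible) (hα : 0 < M.α)
    (h : M.EntryEquilibrium σ e) {i : Fin K} (hi : i ∈ e) (hσ : σ i ≠ 0) :
    ∃ T ⊆ e, i ∉ T ∧ M.net σ T = M.net σ e := by
  by_contra! hne
  have he := h.bestShare hM hα
  obtain ⟨T₀, hT₀, hmax⟩ := (e.erase i).powerset.exists_max_image (M.net σ) ⟨∅, by simp⟩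
  rw [Finset.mem_powerset, Finset.subset_erase] at hT₀
  have hlt : M.net σ T₀ < M.net σ e :=
    lt_of_le_of_ne (he.1.2 T₀ hT₀.1) (hne T₀ hT₀.1 hT₀.2)
  obtain ⟨δ, hδ0, hδ1, hδ2⟩ : ∃ δ > 0, M.weight i (σ i) + δ ≤ M.weight i 0 ∧
      M.α * δ < M.net σ e - M.net σ T₀ := by
    refine ⟨min (M.weight i 0 - M.weight i (σ i)) ((M.net σ e - M.net σ T₀) / (2 * M.α)),
      lt_min (sub_pos.2 (weight_lt_weight_zero hM i hσ)) (div_pos (by linarith) (by linarith)),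
      ?_, ?_⟩
    · linarith [min_le_left (M.weight i 0 - M.weight i (σ i))
        ((M.net σ e - M.net σ T₀) / (2 * M.α))]
    · have := min_le_right (M.weight i 0 - M.weight i (σ i))
        ((M.net σ e - M.net σ T₀) / (2 * M.α))
      rw [le_div_iff₀ (by linarith)] at this
      linarith
  have hw := weight_pos hM i (σ i)
  obtain ⟨t, ht⟩ := exists_weight_eq hM i (add_pos hw hδ0) hδ1
  obtain ⟨A, hA⟩ := exists_bestShare hM hα (Function.update σ i t) e
  have hH := totalWeight_nonneg hM σ (e.erase i)
  have hiA : i ∈ A := by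
    by_contra hiA
    have h1 := hA.1.2 e subset_rfl
    rw [net_update_of_notMem σ t hiA] at h1
    have h2 := hmax A (Finset.mem_powerset.2 (Finset.subset_erase.2 ⟨hA.1.1, hiA⟩))
    have h3 := gain_add_sub_gain_le (totalWeight_nonneg hM σ e) hδ0.le
    rw [net, totalWeight_update_of_mem σ t hi, ht, ← add_assoc, totalWeight_erase_add σ hi] at h1
    have h4 : M.net σ e = e.card / 2 - M.α * gain (M.totalWeight σ e) := rfl
    nlinarith
  have h1 := h i t e (fun _ _ => Iff.rfl) e A he hA
  rw [payoff_of_mem hi hiA, payoff_of_mem hi hi, marg_update σ t hiA, marg_eq σ hi, ht] at h1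
  have h2 := gain_increment_le (totalWeight_nonneg hM σ (A.erase i))
    (totalWeight_mono hM σ (Finset.erase_subset_erase i hA.1.1)) (add_pos hw hδ0).le
  have h3 := gain_lt_gain (h := M.totalWeight σ (e.erase i) + M.weight i (σ i))
    (h' := M.totalWeight σ (e.erase i) + (M.weight i (σ i) + δ)) (by linarith) (by linarith)
  nlinarith [hM.β_pos]

/-- In equilibrium the user is indifferent between sharing with all entrants and with nobody: the
platforms in her smallest best reply add no noise, so that by the privacy assumption she gains
nothing from it. -/
lemma net_eq_zero (hM : M.Admissible) (hα : 0 < M.α) (h : M.EntryEquilibrium σ e) :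
    M.net σ e = 0 := by
  have he := (h.bestShare hM hα).1.2
  refine le_antisymm ?_ (by simpa [net_empty] using he ∅ (Finset.empty_subset _))
  obtain ⟨T, hT, hmin⟩ := (e.powerset.filter fun T => M.net σ T = M.net σ e).exists_min_image
    Finset.card ⟨e, by simp⟩
  simp only [Finset.mem_filter, Finset.mem_powerset] at hT hmin
  have hσ : ∀ i ∈ T, σ i = 0 := by
    intro i hi
    by_contra hσ
    obtain ⟨T', hT', hiT', hnet⟩ := h.exists_net_eq_of_noise_ne_zero hM hα (hT.1 hi) hσ
    have h1 := net_supermodular hM hα σ T T'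
    have h2 := he _ (Finset.union_subset hT.1 hT')
    have h3 := he _ ((Finset.inter_subset_left (s₁ := T) (s₂ := T')).trans hT.1)
    have h4 := hmin (T ∩ T') ⟨Finset.inter_subset_left.trans hT.1, by linarith [hT.2]⟩
    have h5 := Finset.eq_of_subset_of_card_le Finset.inter_subset_left h4
    exact hiT' (Finset.mem_of_mem_inter_right (h5 ▸ hi))
  rw [← hT.2, net, totalWeight_congr (σ' := fun _ => 0) hσ]
  exact net_zero_noise_nonpos hM T

lemma net_nonpos (hM : M.Admissible) (hα : 0 < M.α) (h : M.EntryEquilibrium σ e) :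
    ∀ T ⊆ e, M.net σ T ≤ 0 := by
  rw [← h.net_eq_zero hM hα]
  exact (h.bestShare hM hα).1.2

lemma gain_totalWeight (hM : M.Admissible) (hα : 0 < M.α) (h : M.EntryEquilibrium σ e) :
    gain (M.totalWeight σ e) = e.card / (2 * M.α) := by
  rw [(net_eq_zero_iff hM hα σ e).1 (h.net_eq_zero hM hα),
    gain_threshold hα (card_lt_two_mul_alpha hM hα e)]

lemma marg_le (hM : M.Admissible) (hα : 0 < M.α) (h : M.EntryEquilibrium σ e) {i : Fin K}
    (hi : i ∈ e) : M.marg σ e i ≤ 1 / (2 * M.α) := by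
  have h0 := h.net_eq_zero hM hα
  have h1 := h.net_nonpos hM hα _ (Finset.erase_subset i e)
  have h2 : ((e.erase i).card : ℝ) + 1 = e.card := by exact_mod_cast Finset.card_erase_add_one hi
  rw [le_div_iff₀ (by positivity), marg]
  unfold net at h0 h1
  nlinarith

lemma payoff_nonneg (hM : M.Admissible) (hα : 0 < M.α) (h : M.EntryEquilibrium σ e) {i : Fin K}
    (hi : i ∈ e) : 0 ≤ 1 / 2 + M.β * M.marg σ e i - M.c i := by
  obtain ⟨A, hA⟩ := exists_bestShare hM hα (Function.update σ i (σ i)) (e.erase i)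
  have := h i (σ i) (e.erase i) (fun j hj => by simp [hj]) e A (h.bestShare hM hα) hA
  rwa [payoff_of_mem hi hi, payoff_of_notMem (Finset.notMem_erase i e)] at this

lemma payoff_insert_nonpos (hM : M.Admissible) (hα : 0 < M.α) (h : M.EntryEquilibrium σ e)
    {i : Fin K} (hi : i ∉ e) {t : ℝ≥0}
    (ht : M.totalWeight σ e + M.weight i t ≤ M.threshold (e.card + 1)) :
    1 / 2 + M.β * (gain (M.totalWeight σ e + M.weight i t) - gain (M.totalWeight σ e)) ≤
      M.c i := by
  have hi' := Finset.mem_insert_self i e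
  have hb := bestShare_insert hM hα (h.net_nonpos hM hα) (h.net_eq_zero hM hα) hi (t := t) (by
    rw [net_nonneg_iff hM hα, totalWeight_update_of_mem σ t hi', Finset.erase_insert hi,
      Finset.card_insert_of_notMem hi]
    exact_mod_cast ht)
  have := h i t (insert i e) (fun j hj => by simp [hj]) e _ (h.bestShare hM hα) hb
  rw [payoff_of_mem hi' hi', payoff_of_notMem hi, marg_update σ t hi', Finset.erase_insert hi]
    at this
  linarith

lemma lowCost_subset (hM : M.Admissible) (hα : 0 < M.α) (h : M.EntryEquilibrium σ e) :
    M.lowCost ⊆ e := by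
  intro i hi
  by_contra hie
  have hc : M.c i < 1 / 2 := by simpa [lowCost] using hi
  have hi' := Finset.mem_insert_self i e
  obtain ⟨t, ht⟩ := exists_noise_mem_bestShare hM hα i
  obtain ⟨A, hA⟩ := exists_bestShare hM hα (Function.update σ i t) (insert i e)
  have := h i t (insert i e) (fun j hj => by simp [hj]) e A (h.bestShare hM hα) hA
  rw [payoff_of_mem hi' (ht σ _ A hi' hA), payoff_of_notMem hie] at this
  have := mul_nonneg hM.β_pos.le (marg_nonneg hM (Function.update σ i t) A i)
  linarith

/-- If `β` is at least the upper threshold, platforms stay out only if their entry would not affect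
welfare. If the entrant can make the user indifferent, it earns `1 / 2 + β / (2α)`. Otherwise it
enters without noise; its marginal information then exceeds the one at the noise levels of
`exists_indifferent_of_noiseless`, where the others reveal more, so that entry pays strictly. -/
lemma le_cost_of_notMem (hM : M.Admissible) (hα : 0 < M.α) (hβ : M.HighBeta)
    (h : M.EntryEquilibrium σ e) {i : Fin K} (hi : i ∉ e) :
    1 / 2 + M.β / (2 * M.α) ≤ M.c i := by
  have hcard : ((insert i e).card : ℝ) = e.card + 1 := by
    exact_mod_cast Finset.card_insert_of_notMem hi
  have hn := card_lt_two_mul_alpha hM hα (insert i e)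
  rw [hcard] at hn
  have hW := totalWeight_nonneg hM σ e
  have hg := gain_threshold hα hn
  have hge := h.gain_totalWeight hM hα
  have hlt : M.totalWeight σ e < M.threshold (e.card + 1) := by
    by_contra! hle
    have := gain_le_gain (threshold_nonneg hα (by positivity) hn) hle
    rw [hg, hge, div_le_div_iff_of_pos_right (by linarith)] at this
    linarith
  rcases le_or_gt (M.threshold (e.card + 1) - M.totalWeight σ e) (M.weight i 0) with hle | hgt
  · obtain ⟨t, ht⟩ := exists_weight_eq hM i (sub_pos.2 hlt) hle
    have := h.payoff_insert_nonpos hM hα hi (t := t) (by linarith)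
    rw [ht, add_sub_cancel, hg, hge] at this
    have h2 : M.β * ((e.card + 1) / (2 * M.α) - e.card / (2 * M.α)) = M.β / (2 * M.α) := by ring
    linarith
  · exfalso
    have hw := weight_pos hM i 0
    have h1 := h.payoff_insert_nonpos hM hα hi (t := 0) (by linarith)
    obtain ⟨σ', hσ', hσi, A, hA, hAe, hA0⟩ :=
      exists_indifferent_of_noiseless hM hα (insert i e) i
    rw [Finset.erase_insert hi] at hAe
    have hiA : i ∈ A := by
      by_contra hiA
      -- otherwise the user would not lose from sharing with the others and platform `i`
      have hAeq : A = e := ((Finset.subset_insert_iff_of_notMem hiA).1 hA).antisymm hAe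
      rw [hAeq, net_eq_zero_iff hM hα, ← (net_eq_zero_iff hM hα σ e).1 (h.net_eq_zero hM hα)]
        at hA0
      have := (mem_region_empty_iff hM).1 hσ' (insert i e) subset_rfl
      rw [net_nonpos_iff hM hα, hcard, totalWeight_insert _ hi, hσi, hA0] at this
      linarith
    have hAeq : A = insert i e := hA.antisymm (Finset.insert_subset hiA hAe)
    rw [hAeq] at hA0
    have hσ1 : σ' ∈ M.region univ (insert i e) := by
      rw [mem_region_univ_iff hM, hA0]
      exact (mem_region_empty_iff hM).1 hσ'
    have h2 := hβ.cost_sub_half_le hM (Finset.mem_insert_self i e) hσ1 hσ'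
    rw [net_eq_zero_iff hM hα, hcard, totalWeight_insert _ hi, hσi] at hA0
    rw [marg_eq _ (Finset.mem_insert_self i e), Finset.erase_insert hi, hσi] at h2
    have h3 := gain_increment_lt hW (h' := M.totalWeight σ' e) (by linarith) hw
    nlinarith [mul_lt_mul_of_pos_left h3 hM.β_pos]

end EntryEquilibrium

lemma IsEquilibrium.entryEquilibrium (hM : M.Admissible) {s : Profile K}
    (hs : M.IsEquilibrium s) : M.EntryEquilibrium s.σ s.e :=
  ((hs.competitive hM).platformEquilibrium_iff hM hs.user).1 hs.platform

/-- The welfare of an equilibrium: every entrant contributes `1 / 2` to the platforms and, the user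
being indifferent, `1 / (2α)` to the information of the buyer. -/
theorem IsEquilibrium.welfare_eq_sum (hM : M.Admissible) (hα : 0 < M.α) {s : Profile K}
    (hs : M.IsEquilibrium s) :
    M.welfare s = ∑ i ∈ s.e, (1 / 2 + M.β / (2 * M.α) - M.c i) := by
  have hc := hs.competitive hM
  have h := hs.entryEquilibrium hM
  have hA : s.e ∩ s.user s.σ s.e = s.e :=
    ((hc.userOptimal_iff hM).1 hs.user s.σ s.e).1.unique (h.bestShare hM hα)
  rw [hc.welfare_eq hM hA, h.net_eq_zero hM hα, h.gain_totalWeight hM hα]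
  simp only [Finset.sum_sub_distrib, Finset.sum_add_distrib, Finset.sum_const, nsmul_eq_mul]
  ring

theorem IsEquilibrium.welfare_eq_of_highBeta (hM : M.Admissible) (hα : 0 < M.α)
    (hβ : M.HighBeta) {s : Profile K} (hs : M.IsEquilibrium s) :
    M.welfare s = ∑ i, (1 / 2 + M.β / (2 * M.α) - M.c i) := by
  rw [hs.welfare_eq_sum hM hα]
  refine Finset.sum_subset (Finset.subset_univ _) fun i _ hi => ?_
  have h1 := (hs.entryEquilibrium hM).le_cost_of_notMem hM hα hβ hi
  have h2 := hβ.cost_le hM hα i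
  linarith

/-- If `β` is at most the lower threshold, high-cost platforms enter only if this does not affect
welfare. -/
theorem IsEquilibrium.welfare_eq_of_lowBeta (hM : M.Admissible) (hα : 0 < M.α)
    (hβ : M.LowBeta) {s : Profile K} (hs : M.IsEquilibrium s) :
    M.welfare s = ∑ i ∈ M.lowCost, (1 / 2 + M.β / (2 * M.α) - M.c i) := by
  have h := hs.entryEquilibrium hM
  rw [hs.welfare_eq_sum hM hα]
  refine (Finset.sum_subset (h.lowCost_subset hM hα) fun i hi hi' => ?_).symm
  have hc : 1 / 2 < M.c i := by
    refine lt_of_le_of_ne ?_ (hβ.1 i).symm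
    simpa [lowCost] using hi'
  have h1 := hβ.le_cost hM hα hc
  have h2 := h.payoff_nonneg hM hα hi
  have h3 := mul_le_mul_of_nonneg_left (h.marg_le hM hα hi) hM.β_pos.le
  rw [mul_one_div] at h3
  linarith

end Market
end DataMarket

namespace DataMarket
namespace Market

variable {K d : ℕ} {M : Market K d}

/-! ### Existence of equilibria -/

/-- If the user drops some of the others when platform `i` lowers its precision from `w` to `v`,
then `v < w / 2`. Here `m` of the `n` platforms other than `i` stay, all have precision `w`, and
`(1 + (n + 1) w) = 2 α w`, that is, the user was indifferent before. -/
lemma two_mul_lt_of_net_lt {α w v m n : ℝ} (hw : 0 < w) (hv : 0 ≤ v) (hm : 0 ≤ m)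
    (hmn : m < n) (hind : 1 + (n + 1) * w = 2 * α * w)
    (h : (n + 1) / 2 - α * gain (n * w + v) < (m + 1) / 2 - α * gain (m * w + v)) :
    2 * v < w := by
  have hmw : 0 ≤ m * w := mul_nonneg hm hw.le
  have hb : 0 < n - m := sub_pos.2 hmn
  have hinc := gain_add_sub_gain (h := m * w + v) (v := (n - m) * w) (by positivity)
    (by positivity)
  rw [show m * w + v + (n - m) * w = n * w + v by ring,
    show 1 + (m * w + v) + (n - m) * w = 1 + n * w + v by ring] at hinc
  have hnw : 0 ≤ n * w := mul_nonneg (by linarith) hw.le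
  have hP : 0 < (1 + (m * w + v)) * (1 + n * w + v) := by positivity
  have h1 : (n - m) / 2 < α * ((n - m) * w / ((1 + (m * w + v)) * (1 + n * w + v))) := by
    rw [← hinc]; linarith
  rw [← mul_div_assoc, lt_div_iff₀ hP] at h1
  have h2 : (1 + (m * w + v)) * (1 + n * w + v) < 2 * α * w := by
    by_contra! hle
    nlinarith [mul_le_mul_of_nonneg_left hle hb.le]
  nlinarith [mul_nonneg hmw hnw, mul_nonneg hmw hv, mul_nonneg hv hnw, mul_nonneg hv hv]

/-- With `n + 1` platforms of precision `w` and `(n + 1) w ≤ 1 / 3`, the marginal information of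
each is at least `w / 2`. -/
lemma half_le_gain_increment {w n : ℝ} (hw : 0 < w) (hn : 0 ≤ n) (h : (n + 1) * w ≤ 1 / 3) :
    w / 2 ≤ gain (n * w + w) - gain (n * w) := by
  have hnw : 0 ≤ n * w := mul_nonneg hn hw.le
  rw [gain_add_sub_gain hnw hw.le]
  refine div_le_div_of_nonneg_left hw.le (by positivity) ?_
  nlinarith

/-- The equal noise profile: if `α` is large, all platforms in `e` can be given the same precision
`1 / (2α - #e)`, at which the user is indifferent between sharing with all of them and with nobody.
This is an equilibrium if entry pays for the platforms in `e` at such noise levels, and does not pay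
for the others whenever the user shares with them. -/
theorem exists_entryEquilibrium (hM : M.Admissible) (hα : 0 < M.α) (e : Finset (Fin K))
    (he : 2 * (e.card : ℝ) ≤ M.α) (hw : ∀ i ∈ e, 1 / (2 * M.α - e.card) ≤ M.weight i 0)
    (hin : ∀ i ∈ e, ∀ σ ∈ M.region univ e ∩ M.region ∅ e,
      0 ≤ 1 / 2 + M.β * M.marg σ e i - M.c i)
    (hout : ∀ i ∉ e, ∀ A, i ∈ A → ∀ σ ∈ M.region univ A,
      1 / 2 + M.β * M.marg σ A i - M.c i ≤ 0) :
    ∃ σ, M.EntryEquilibrium σ e := by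
  have hD : 0 < 2 * M.α - e.card := by linarith
  set w := 1 / (2 * M.α - e.card) with hwdef
  have hw0 : 0 < w := by positivity
  have hwD : w * (2 * M.α - e.card) = 1 := one_div_mul_cancel hD.ne'
  have hex : ∀ i, ∃ t, i ∈ e → M.weight i t = w := by
    intro i
    by_cases hi : i ∈ e
    · obtain ⟨t, ht⟩ := exists_weight_eq hM i hw0 (hw i hi)
      exact ⟨t, fun _ => ht⟩
    · exact ⟨0, fun h => absurd h hi⟩
  choose σ hσ using hex
  have hW : ∀ T ⊆ e, M.totalWeight σ T = T.card * w := fun T hT => by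
    rw [totalWeight, Finset.sum_congr rfl fun i hi => hσ i (hT hi), Finset.sum_const, nsmul_eq_mul]
  have hthr : ∀ k : ℝ, k < 2 * M.α → M.threshold k = k / (2 * M.α - k) := fun k hk => by
    have : 2 * M.α - k ≠ 0 := by linarith
    unfold threshold
    field_simp
  have hthre : M.threshold e.card = e.card * w := by
    rw [hthr _ (by linarith), hwdef, mul_one_div]
  have hnonpos : ∀ T ⊆ e, M.net σ T ≤ 0 := by
    intro T hT
    have hc : (T.card : ℝ) ≤ e.card := by exact_mod_cast Finset.card_le_card hT
    rw [net_nonpos_iff hM hα, hW T hT, hthr _ (by linarith), hwdef, mul_one_div]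
    exact div_le_div_of_nonneg_left (by positivity) hD (by linarith)
  have hnet0 : M.net σ e = 0 := by rw [net_eq_zero_iff hM hα, hW e subset_rfl, hthre]
  have hbest : M.BestShare σ e e := bestShare_self (by rwa [hnet0])
  have hreg : σ ∈ M.region univ e ∩ M.region ∅ e :=
    ⟨(mem_region_univ_iff hM).2 (by rwa [hnet0]), (mem_region_empty_iff hM).2 hnonpos⟩
  refine ⟨σ, fun i t e' he' A A' hA hA' => ?_⟩
  rw [hA.unique hbest]
  by_cases hi : i ∈ e
  · have hpay := hin i hi σ hreg
    rw [payoff_of_mem hi hi]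
    by_cases hi' : i ∈ e'
    swap
    · rwa [payoff_of_notMem hi']
    have hee : e' = e := by
      ext j
      by_cases hj : j = i
      · subst hj; simp [hi, hi']
      · exact he' j hj
    subst hee
    by_cases hiA : i ∈ A'
    swap
    · rw [payoff_of_notMem_share hi hiA]
      linarith [hM.cost_nonneg i]
    rw [payoff_of_mem hi hiA]
    suffices M.marg (Function.update σ i t) A' i ≤ M.marg σ e' i by
      linarith [mul_le_mul_of_nonneg_left this hM.β_pos.le]
    have hv := weight_nonneg hM i t
    have hWe := hW _ (Finset.erase_subset i e')
    have hWA := hW _ ((Finset.erase_subset i A').trans hA'.1.1)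
    have hce : ((e'.erase i).card : ℝ) + 1 = e'.card := by
      exact_mod_cast Finset.card_erase_add_one hi
    have hcA : ((A'.erase i).card : ℝ) + 1 = A'.card := by
      exact_mod_cast Finset.card_erase_add_one hiA
    rw [marg_update σ t hiA, marg_eq σ hi, hσ i hi, hWe, hWA]
    by_cases hAe : A' = e'
    · -- a higher precision would make the user drop platform `i`
      subst hAe
      have h1 : 0 ≤ M.net (Function.update σ i t) A' := by
        simpa [net_empty] using hA'.1.2 ∅ (Finset.empty_subset _)
      rw [net_nonneg_iff hM hα, totalWeight_update_of_mem σ t hi, hWe, hthre, ← hce] at h1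
      have h2 := gain_le_gain (h := (A'.erase i).card * w + M.weight i t)
        (h' := (A'.erase i).card * w + w) (by positivity) (by linarith)
      linarith
    · -- a much lower precision makes the user drop others, but then `i` reveals too little
      have hlt : M.net (Function.update σ i t) e' < M.net (Function.update σ i t) A' := by
        by_contra! hle
        have hmem : e' ∈ {A | A ⊆ e' ∧ ∀ T ⊆ e', M.net (Function.update σ i t) T ≤
            M.net (Function.update σ i t) A} :=
          ⟨subset_rfl, fun T hT => (hA'.1.2 T hT).trans hle⟩
        exact hAe (hA'.1.1.antisymm (hA'.2 hmem))
      have hcard : ((A'.erase i).card : ℝ) < (e'.erase i).card := by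
        have : A'.card < e'.card := Finset.card_lt_card (hA'.1.1.ssubset_of_ne hAe)
        have : (A'.card : ℝ) < e'.card := by exact_mod_cast this
        linarith
      rw [net, net, totalWeight_update_of_mem σ t hi, totalWeight_update_of_mem σ t hiA, hWe, hWA,
        ← hce, ← hcA] at hlt
      rw [← hce] at hwD he
      have h1 := two_mul_lt_of_net_lt hw0 hv (by positivity) hcard (by linarith) hlt
      have h2 := half_le_gain_increment (n := (e'.erase i).card) hw0 (by positivity) (by
        nlinarith)
      have h3 := gain_add_sub_gain_le (h := (A'.erase i).card * w) (by positivity) hv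
      linarith
  · rw [payoff_of_notMem hi]
    by_cases hi' : i ∈ e'
    swap
    · rw [payoff_of_notMem hi']
    by_cases hiA : i ∈ A'
    · rw [payoff_of_mem hi' hiA]
      exact hout i hi A' hiA _
        ((mem_region_univ_iff hM).2 fun T hT => hA'.1.2 T (hT.trans hA'.1.1))
    · rw [payoff_of_notMem_share hi' hiA]
      linarith [hM.cost_nonneg i]

/-- All platforms enter in the first regime, the low-cost platforms in the second. -/
theorem exists_isEquilibrium (hM : M.Admissible) (hα : 0 < M.α) (hK : 2 * (K : ℝ) ≤ M.α)
    (hγ : ∀ i, 2 ≤ M.α * M.γ i ^ 2) (h : M.HighBeta ∨ M.LowBeta) :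
    ∃ s, M.IsEquilibrium s := by
  have hcard : ∀ e : Finset (Fin K), (e.card : ℝ) ≤ K := fun e => by
    exact_mod_cast card_finset_fin_le e
  have hw : ∀ (e : Finset (Fin K)) (i : Fin K), 1 / (2 * M.α - e.card) ≤ M.weight i 0 := by
    intro e i
    have h1 := hcard e
    have h2 := noise_pos hM i 0
    have hK0 : (0 : ℝ) ≤ K := by positivity
    rw [weight, div_le_div_iff₀ (by linarith) h2]
    simp only [NNReal.coe_zero]
    nlinarith [hγ i, mul_nonneg (sq_nonneg (M.γ i)) (by linarith : 0 ≤ M.α - e.card)]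
  obtain ⟨σ, hσ⟩ : ∃ σ e, M.EntryEquilibrium σ e := by
    rcases h with h | h
    · obtain ⟨σ, hσ⟩ := exists_entryEquilibrium hM hα univ (by linarith [hcard univ])
        (fun i _ => hw _ i)
        (fun i hi σ hσ => by linarith [h.cost_sub_half_le hM hi hσ.1 hσ.2])
        (fun i hi => absurd (Finset.mem_univ i) hi)
      exact ⟨σ, _, hσ⟩
    · obtain ⟨σ, hσ⟩ := exists_entryEquilibrium hM hα M.lowCost (by linarith [hcard M.lowCost])
        (fun i _ => hw _ i)
        (fun i hi σ _ => by
          have h1 : M.c i < 1 / 2 := by simpa [lowCost] using hi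
          have h2 := mul_nonneg hM.β_pos.le (marg_nonneg hM σ M.lowCost i)
          linarith)
        (fun i hi A hiA σ hσ => by
          have h1 : 1 / 2 < M.c i := lt_of_le_of_ne (by simpa [lowCost] using hi) (h.1 i).symm
          linarith [h.le_cost_sub_half hM h1 hiA hσ])
      exact ⟨σ, _, hσ⟩
  obtain ⟨e, he⟩ := hσ
  exact he.exists_isEquilibrium hM hα

/-! ### Comparing markets -/

lemma sum_le_sum_of_injective {ι κ : Type*} [DecidableEq κ] {f : ι → κ}
    (hf : Function.Injective f) {S : Finset ι} {T : Finset κ} {g : ι → ℝ} {g' : κ → ℝ}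
    (hST : ∀ i ∈ S, f i ∈ T) (hg : ∀ i, g i = g' (f i)) (h0 : ∀ j ∈ T, 0 ≤ g' j) :
    ∑ i ∈ S, g i ≤ ∑ j ∈ T, g' j ∧
      (S.card < T.card → (∀ j ∈ T, 0 < g' j) → ∑ i ∈ S, g i < ∑ j ∈ T, g' j) := by
  have himg : ∑ i ∈ S, g i = ∑ j ∈ S.image f, g' j := by
    rw [Finset.sum_image hf.injOn]
    exact Finset.sum_congr rfl fun i _ => hg i
  have hsub : S.image f ⊆ T := Finset.image_subset_iff.2 hST
  rw [himg]
  refine ⟨Finset.sum_le_sum_of_subset_of_nonneg hsub fun j hj _ => h0 j hj, fun hc hpos => ?_⟩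
  obtain ⟨j, hj, hj'⟩ := Finset.exists_mem_notMem_of_card_lt_card
    (s := S.image f) (t := T) (by rwa [Finset.card_image_of_injective S hf])
  exact Finset.sum_lt_sum_of_subset hsub hj hj' (hpos j hj) fun j hj _ => h0 j hj

end Market

lemma alphaBar_pos (K : ℕ) : 0 < alphaBar K := by unfold alphaBar; positivity

end DataMarket

theorem corollary1 :
    -- the welfare of every equilibrium, in both regimes
    (∀ (K d : ℕ) (M : DataMarket.Market K d), M.Admissible → DataMarket.alphaBar K ≤ M.α →
      (M.HighBeta → ∀ s, M.IsEquilibrium s →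
        M.welfare s = (K : ℝ) * (1 / 2 + M.β / (2 * M.α)) - ∑ i, M.c i) ∧
      (M.LowBeta → ∀ s, M.IsEquilibrium s →
        M.welfare s =
          (M.lowCost.card : ℝ) * (1 / 2 + M.β / (2 * M.α)) - ∑ i ∈ M.lowCost, M.c i)) ∧
    -- equilibria exist in both regimes once `α` is large in terms of the characteristics
    (∀ (K d : ℕ) (x : Fin K → EuclideanSpace ℝ (Fin d)) (y : EuclideanSpace ℝ (Fin d)),
      ∃ α₀ : ℝ, ∀ M : DataMarket.Market K d, M.x = x → M.y = y → M.Admissible → α₀ ≤ M.α →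
        M.HighBeta ∨ M.LowBeta → ∃ s, M.IsEquilibrium s) ∧
    -- equilibrium welfare increases when platforms (low-cost platforms) are added
    (∀ (K K' d : ℕ) (M : DataMarket.Market K d) (M' : DataMarket.Market K' d),
      M.IsSubmarket M' → M.Admissible → M'.Admissible → DataMarket.alphaBar K' ≤ M'.α →
      ∀ s s', M.IsEquilibrium s → M'.IsEquilibrium s' →
        (M.HighBeta → M'.HighBeta →
          M.welfare s ≤ M'.welfare s' ∧
          (K < K' → M'.betaBar < (M'.β : EReal) → M.welfare s < M'.welfare s')) ∧
        (M.LowBeta → M'.LowBeta →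
          M.welfare s ≤ M'.welfare s' ∧
          (M.lowCost.card < M'.lowCost.card → M.welfare s < M'.welfare s'))) := by
  refine ⟨fun K d M hM hMα => ?_, fun K d x y => ?_, fun K K' d M M' hsub hM hM' hMα s s' hs hs' =>
    ?_⟩
  · have hα := (DataMarket.alphaBar_pos K).trans_le hMα
    refine ⟨fun hβ s hs => ?_, fun hβ s hs => ?_⟩
    · rw [hs.welfare_eq_of_highBeta hM hα hβ, Finset.sum_sub_distrib]
      simp [mul_add]
    · rw [hs.welfare_eq_of_lowBeta hM hα hβ, Finset.sum_sub_distrib]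
      simp [mul_add]
  · -- `α ≥ 2 / γ_i²` lets the noiseless signals reveal enough
    refine ⟨2 * K + 1 + ∑ i, 2 / (inner ℝ (x i) y : ℝ) ^ 2, fun M hx hy hM hMα h => ?_⟩
    subst hx hy
    have hterm : ∀ i, 0 ≤ 2 / (inner ℝ (M.x i) M.y : ℝ) ^ 2 := fun i => by positivity
    have hsum := Finset.sum_nonneg fun i (_ : i ∈ Finset.univ) => hterm i
    have hK : (0 : ℝ) ≤ K := by positivity
    refine DataMarket.Market.exists_isEquilibrium hM (by linarith) (by linarith) (fun i => ?_) h
    have h1 := Finset.single_le_sum (fun i _ => hterm i) (Finset.mem_univ i)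
    have hγ : 0 < M.γ i ^ 2 := sq_pos_of_ne_zero (DataMarket.Market.γ_ne_zero hM i)
    rw [← div_le_iff₀ hγ]
    change 2 / M.γ i ^ 2 ≤ _ at h1
    linarith
  · have hα' := (DataMarket.alphaBar_pos K').trans_le hMα
    obtain ⟨-, hαeq, hβeq, f, hf, -, hc⟩ := hsub
    have hα : 0 < M.α := hαeq ▸ hα'
    refine ⟨fun hβ hβ' => ?_, fun hβ hβ' => ?_⟩
    · rw [hs.welfare_eq_of_highBeta hM hα hβ, hs'.welfare_eq_of_highBeta hM' hα' hβ']
      have h := DataMarket.Market.sum_le_sum_of_injective hf (S := Finset.univ) (T := Finset.univ)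
        (g := fun i => 1 / 2 + M.β / (2 * M.α) - M.c i)
        (g' := fun j => 1 / 2 + M'.β / (2 * M'.α) - M'.c j) (fun i _ => Finset.mem_univ _)
        (fun i => by rw [hαeq, hβeq, hc]) (fun j _ => sub_nonneg.2 (hβ'.cost_le hM' hα' j))
      refine ⟨h.1, fun hK hlt => h.2 (by simpa using hK) fun j _ => sub_pos.2 ?_⟩
      exact DataMarket.Market.cost_lt_of_betaBar_lt hM' hα' hlt j
    · rw [hs.welfare_eq_of_lowBeta hM hα hβ, hs'.welfare_eq_of_lowBeta hM' hα' hβ']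
      have hpos : ∀ j ∈ M'.lowCost, 0 < 1 / 2 + M'.β / (2 * M'.α) - M'.c j := by
        intro j hj
        have h1 : M'.c j < 1 / 2 := by simpa [DataMarket.Market.lowCost] using hj
        have h2 := div_pos hM'.β_pos (by linarith : 0 < 2 * M'.α)
        linarith
      have h := DataMarket.Market.sum_le_sum_of_injective hf (S := M.lowCost) (T := M'.lowCost)
        (g := fun i => 1 / 2 + M.β / (2 * M.α) - M.c i)
        (g' := fun j => 1 / 2 + M'.β / (2 * M'.α) - M'.c j)
        (fun i hi => by simpa [DataMarket.Market.lowCost, hc] using hi)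
        (fun i => by rw [hαeq, hβeq, hc]) (fun j hj => (hpos j hj).le)
      exact ⟨h.1, fun hcard => h.2 hcard hpos⟩
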